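/- **Setting.** A *code subspace renormalization scheme* over a partially ordered set $\Lambda$ consists of: a von Neumann factor $M$ acting on a Hilbert space $\mathcal H$ with a cyclic and separating unit vector $\Omega$ (so that $\mathcal H$ is the GNS space of the faithful normal state $\omega=\langle\Omega,\cdot\,\Omega\rangle$ on $M$); type I subfactors $M_\lambda\subset M$, $\lambda\in\Lambda$, with $M_\mu\subset M_\lambda$ for $\mu\le\lambda$; faithful normal conditional expectations $\mathcal E_\lambda:M\to M_\lambda$ and $E_{\lambda\mu}:M_\lambda\to M_\mu$ ($\mu\le\lambda$) with $\mathcal E_\mu=E_{\lambda\mu}\circ\mathcal E_\lambda$, $E_{\lambda\nu}=E_{\mu\nu}\circ E_{\lambda\mu}$ and $\omega\circ\mathcal E_\lambda=\omega$. Put $\mathcal H_\lambda=\overline{M_\lambda\Omega}$, $M_\lambda^L=M_\lambda$, let $M_\lambda^R$ be the commutant of $M_\lambda$ on $\mathcal H_\lambda$, and, for $\mu\le\lambda$, let $M_{\lambda\mu}=M_\lambda\cap M_\mu'$, so that $M_\lambda=M_\mu\otimes M_{\lambda\mu}$. For a possibly subnormalized vector $v$ and a finite type I factor $\mathcal A$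 with trace $\mathrm{Tr}$, $S(v,\mathcal A)=-\mathrm{Tr}\,\rho\log\rho$, where $\rho$ is the density of $x\mapsto\langle v,xv\rangle$ on $\mathcal A$. If $M_\lambda$ is finite-dimensional, of dimension $d_\lambda^2$, then $\mathcal H_\lambda=\mathcal K_L\otimes\mathcal K_R$ with $M_\lambda=\mathcal B(\mathcal K_L)\otimes1$ and $\dim\mathcal K_L=\dim\mathcal K_R=d_\lambda$. For a map $V:\mathcal H\to\mathcal H_N^L\otimes\mathcal H_N^R$ the *area term* is $A(\mathcal H_{L,\lambda})=S\big((V|_{\mathcal H_\lambda}\otimes1)|\mathrm{MAX}\rangle,\ \mathcal B(\mathcal H_N^L)\otimes\mathcal B(\mathcal K_L^{ref})\big)$, where $|\mathrm{MAX}\rangle$ is the normalized vector maximally entangling $\mathcal K_L,\mathcal K_R$ with reference copies $\mathcal K_L^{ref},\mathcal K_R^{ref}$. **Theorem.** For each $N\in\mathbb N$ let a code subspace renormalization scheme over a fixed $\Lambda$ be given (it may depend on $N$, which is suppressed from the notation), together with a finite-dimensional Hilbert space $\mathcal H_N$ and a contraction $V_N:\mathcal H\to\mathcal H_N\otimes\mathcal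 H_N=\mathcal H_N^L\otimes\mathcal H_N^R$. Let $\lambda\ge\mu$ in $\Lambda$, and let $\Psi\in\mathcal H_\mu$ be normalized (possibly depending on $N$). Assume: 1. $M_\lambda$ is finite-dimensional, of dimension $d_\lambda^2$ independent of $N$; 2. $\log\dim\mathcal H_N\le P(N)$ for some polynomial $P$; 3. $\|V_N\Psi\|\to1$ as $N\to\infty$; 4. there is a sequence $\delta_N$ decaying faster than any power of $N$ such that for every $N$ and all unitaries $\hat U^L\in M^L_\lambda$, $\hat U^R\in M^R_\lambda$ there are Borel measurable maps $U^L\mapsto\tilde U^L$ and $U^R\mapsto\tilde U^R$ from the unitary groups of $M_\lambda^L$ and $M_\lambda^R$ to those of $\mathcal B(\mathcal H_N^L)$ and $\mathcal B(\mathcal H_N^R)$ with $$\|V_NU^RU^L\Psi-\tilde U^R\tilde U^LV_N\hat U^R\hat U^L\Psi\|\le\delta_N\qquad\text{for all unitaries } U^L\in M_\lambda^L,\ U^R\in M_\lambda^R .$$ Then for all unitaries $\hat U^L_\mu\in M_\mu^L$, $\hat U^R_\mu\in M_\mu^R$ (possibly depending on $N$), as $N\to\infty$, $$|S(\Psi,M_\mu)+A(\mathcal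 H_{L,\mu})-S(V_N\hat U^L_\mu\hat U^R_\mu\Psi,\mathcal B(\mathcal H^L_N))|\to0,$$ $$|S(\Psi,M_\mu)+S(\Psi,M_{\lambda\mu})+A(\mathcal H_{L,\lambda})-S(V_N\hat U^L_\mu\hat U^R_\mu\Psi,\mathcal B(\mathcal H^L_N))|\to0.$$ In particular $$|A(\mathcal H_{L,\mu})-(S(\Psi,M_{\lambda\mu})+A(\mathcal H_{L,\lambda}))|\to0 .$$ -/

import Mathlib

open scoped TensorProduct
open Filter Topology

noncomputable section

namespace LargeNCode

/-! ### Von Neumann entropy of a state on a finite type I factor -/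

section Entropy

/-- Von Neumann entropy `-Tr ρ log ρ = ∑ -p log p`, the sum running over the eigenvalues `p` of the
(possibly subnormalized) density matrix `ρ`, with multiplicity; `0 log 0 = 0`. -/
def matrixEntropy {n : ℕ} (ρ : Matrix (Fin n) (Fin n) ℂ) : ℝ :=
  (ρ.charpoly.roots.map fun z => Real.negMulLog z.re).sum

/-- The density matrix of a functional `φ` on an algebra identified with a full matrix algebra by
`π`: the matrix `ρ` with `Tr (ρ * π x) = φ x` for all `x`
(see `trace_densityMatrix_mul`). -/
def densityMatrix {A : Type*} [Ring A] [Algebra ℂ A] [StarRing A] {n : ℕ}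
    (π : A ≃⋆ₐ[ℂ] Matrix (Fin n) (Fin n) ℂ) (φ : A →ₗ[ℂ] ℂ) : Matrix (Fin n) (Fin n) ℂ :=
  Matrix.of fun i j => φ (π.symm (Matrix.single j i 1))

theorem trace_densityMatrix_mul {A : Type*} [Ring A] [Algebra ℂ A] [StarRing A] {n : ℕ}
    (π : A ≃⋆ₐ[ℂ] Matrix (Fin n) (Fin n) ℂ) (φ : A →ₗ[ℂ] ℂ) (x : A) :
    (densityMatrix π φ * π x).trace = φ x := by
  have key : ∀ y : Matrix (Fin n) (Fin n) ℂ,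
      (densityMatrix π φ * y).trace = φ (π.symm y) := by
    intro y
    have h1 : π.symm y = ∑ i, ∑ j, y i j • π.symm (Matrix.single i j 1) := by
      conv_lhs => rw [Matrix.matrix_eq_sum_single y]
      rw [map_sum]
      refine Finset.sum_congr rfl fun i _ => ?_
      rw [map_sum]
      refine Finset.sum_congr rfl fun j _ => ?_
      rw [← map_smul, Matrix.smul_single, smul_eq_mul, mul_one]
    rw [h1]
    simp only [map_sum, map_smul, Matrix.trace, Matrix.diag_apply, Matrix.mul_apply, densityMatrix,
      Matrix.of_apply, smul_eq_mul]
    rw [Finset.sum_comm]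
    simp only [mul_comm]
  simpa using key (π x)

open Classical in
/-- The entropy `S(φ, A)` of a positive functional `φ` on a `*`-algebra `A` which is a finite type I
factor, that is, `*`-isomorphic to a full matrix algebra `Mₙ(ℂ)`: the von Neumann entropy of the
density matrix of `φ`. The spectrum of the density matrix does not depend on the identification.
(The value on algebras that are not full matrix algebras is irrelevant, and set to `0`.) -/
def entropy {A : Type*} [Ring A] [Algebra ℂ A] [StarRing A] (φ : A →ₗ[ℂ] ℂ) : ℝ :=
  if h : ∃ n : ℕ, Nonempty (A ≃⋆ₐ[ℂ] Matrix (Fin n) (Fin n) ℂ) then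
    matrixEntropy (densityMatrix h.choose_spec.some φ)
  else 0

/-- The functional `x ↦ ⟨v, x v⟩` on a `*`-algebra of bounded operators. -/
def vectorFunctional {H : Type*} [NormedAddCommGroup H] [InnerProductSpace ℂ H] [CompleteSpace H]
    (A : StarSubalgebra ℂ (H →L[ℂ] H)) (v : H) : A →ₗ[ℂ] ℂ where
  toFun x := inner ℂ v ((x : H →L[ℂ] H) v)
  map_add' x y := by simp
  map_smul' c x := by simp

/-- `S(v, A)` for a vector `v` and a `*`-algebra `A` of operators, a finite type I factor. -/
def vectorEntropy {H : Type*} [NormedAddCommGroup H] [InnerProductSpace ℂ H] [CompleteSpace H]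
    (A : StarSubalgebra ℂ (H →L[ℂ] H)) (v : H) : ℝ :=
  entropy (vectorFunctional A v)

variable {X Y : Type*} [NormedAddCommGroup X] [InnerProductSpace ℂ X] [FiniteDimensional ℂ X]
  [NormedAddCommGroup Y] [InnerProductSpace ℂ Y] [FiniteDimensional ℂ Y]

/-- The functional `T ↦ ⟨v, (T ⊗ 1) v⟩` on `B(X)`, for a vector `v` of `X ⊗ Y`. -/
def leftFunctional (v : X ⊗[ℂ] Y) : (X →ₗ[ℂ] X) →ₗ[ℂ] ℂ where
  toFun T := inner ℂ v (LinearMap.rTensor Y T v)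
  map_add' S T := by simp [LinearMap.rTensor_add, inner_add_right]
  map_smul' c T := by simp [LinearMap.rTensor_smul, inner_smul_right]

/-- `S(v, B(X))` for a (possibly subnormalized) vector `v` of `X ⊗ Y`. -/
def leftEntropy (v : X ⊗[ℂ] Y) : ℝ := entropy (leftFunctional v)

end Entropy

/-! ### Factors and conditional expectations -/

section Operators

variable {H : Type*} [NormedAddCommGroup H] [InnerProductSpace ℂ H] [CompleteSpace H]

/-- A factor: the centre consists of the scalars. -/
def IsFactor (M : VonNeumannAlgebra H) : Prop :=
  ∀ x ∈ M, x ∈ M.commutant → ∃ c : ℂ, x = c • (1 : H →L[ℂ] H)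

/-- A type I factor: a factor with a minimal projection. -/
def IsTypeIFactor (M : VonNeumannAlgebra H) : Prop :=
  IsFactor M ∧ ∃ p ∈ M, IsStarProjection p ∧ p ≠ 0 ∧ ∀ x ∈ M, ∃ c : ℂ, p * x * p = c • p

/-- `E` is a faithful normal conditional expectation of `M` onto the subalgebra `N`. Normality is
preservation of suprema of increasing nets for the order of operators. -/
structure IsFaithfulNormalCondExp (M N : VonNeumannAlgebra H) (hNM : N ≤ M)
    (E : M.toStarSubalgebra →ₗ[ℂ] N.toStarSubalgebra) : Prop where
  map_one : E 1 = 1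
  bimodule : ∀ (n₁ n₂ : N.toStarSubalgebra) (m : M.toStarSubalgebra),
    E (⟨n₁, hNM n₁.2⟩ * m * ⟨n₂, hNM n₂.2⟩) = n₁ * E m * n₂
  positive : ∀ m : M.toStarSubalgebra, 0 ≤ (E (star m * m) : H →L[ℂ] H)
  faithful : ∀ m : M.toStarSubalgebra, E (star m * m) = 0 → m = 0
  normal : ∀ (S : Set M.toStarSubalgebra) (x : M.toStarSubalgebra), S.Nonempty →
    DirectedOn (· ≤ ·) S → IsLUB S x → IsLUB (E '' S) (E x)

/-- The regulated code subspace: the closed linear span of `N Ω`. -/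
def regSpace (N : VonNeumannAlgebra H) (Ω : H) : Submodule ℂ H :=
  (Submodule.span ℂ {v : H | ∃ x ∈ N, v = x Ω}).topologicalClosure

instance (N : VonNeumannAlgebra H) (Ω : H) : CompleteSpace (regSpace N Ω) :=
  inferInstanceAs (CompleteSpace (Submodule.topologicalClosure _))

theorem regSpace_mono {N M : VonNeumannAlgebra H} (h : N ≤ M) (Ω : H) :
    regSpace N Ω ≤ regSpace M Ω := by
  refine Submodule.topologicalClosure_mono (Submodule.span_mono ?_)
  rintro v ⟨x, hx, rfl⟩
  exact ⟨x, h hx, rfl⟩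

theorem map_mem_regSpace (N : VonNeumannAlgebra H) (Ω : H) (x : N.toStarSubalgebra) {v : H}
    (hv : v ∈ regSpace N Ω) : (x : H →L[ℂ] H) v ∈ regSpace N Ω := by
  have hmap : Submodule.span ℂ {v : H | ∃ x ∈ N, v = x Ω} ≤
      (Submodule.span ℂ {v : H | ∃ x ∈ N, v = x Ω}).comap (x : H →L[ℂ] H).toLinearMap := by
    refine Submodule.span_le.2 ?_
    rintro _ ⟨y, hy, rfl⟩
    exact Submodule.subset_span ⟨(x : H →L[ℂ] H) * y, N.mul_mem' x.2 hy, rfl⟩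
  exact map_mem_closure (x : H →L[ℂ] H).continuous hv fun a ha => hmap ha

/-- The action of `x ∈ N` on the regulated code subspace. -/
def leftAction (N : VonNeumannAlgebra H) (Ω : H) (x : N.toStarSubalgebra) :
    regSpace N Ω →L[ℂ] regSpace N Ω :=
  (x : H →L[ℂ] H).restrict fun _ hv => map_mem_regSpace N Ω x hv

/-- The right algebra: the commutant of `N` on the regulated code subspace. -/
def rightAlgebra (N : VonNeumannAlgebra H) (Ω : H) :
    StarSubalgebra ℂ (regSpace N Ω →L[ℂ] regSpace N Ω) :=
  StarSubalgebra.centralizer ℂ (Set.range (leftAction N Ω))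

/-- The unitary groups of the left and right algebras. -/
abbrev LeftUnitary (N : VonNeumannAlgebra H) := unitary N.toStarSubalgebra

abbrev RightUnitary (N : VonNeumannAlgebra H) (Ω : H) := unitary (rightAlgebra N Ω)

/-- The vector `Uᴸ Uᴿ ψ`, for `ψ` in the regulated code subspace. -/
def act {N : VonNeumannAlgebra H} {Ω : H} (UL : LeftUnitary N) (UR : RightUnitary N Ω)
    (ψ : regSpace N Ω) : regSpace N Ω :=
  leftAction N Ω UL.1 (UR.1.1 ψ)

/-! ### The area term -/

/-- An identification of the regulated code subspace with `ℂᵈ ⊗ ℂᵈ` under which `N` acts as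
`B(ℂᵈ) ⊗ 1` (hence the right algebra acts as `1 ⊗ B(ℂᵈ)`). -/
structure Bipartition (N : VonNeumannAlgebra H) (Ω : H) where
  d : ℕ
  Φ : (EuclideanSpace ℂ (Fin d) ⊗[ℂ] EuclideanSpace ℂ (Fin d)) ≃ₗᵢ[ℂ] regSpace N Ω
  left_of_mem : ∀ x : N.toStarSubalgebra,
    ∃ T : EuclideanSpace ℂ (Fin d) →ₗ[ℂ] EuclideanSpace ℂ (Fin d),
      ∀ v, leftAction N Ω x (Φ v) = Φ (LinearMap.rTensor _ T v)
  mem_of_left : ∀ T : EuclideanSpace ℂ (Fin d) →ₗ[ℂ] EuclideanSpace ℂ (Fin d),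
    ∃ x : N.toStarSubalgebra, ∀ v, leftAction N Ω x (Φ v) = Φ (LinearMap.rTensor _ T v)

/-- The normalized maximally entangled vector of `(K_L ⊗ K_R) ⊗ (K_Lʳᵉᶠ ⊗ K_Rʳᵉᶠ)`, all four spaces
being `ℂᵈ`; the reference spaces are identified with the duals through the standard basis. -/
def maxEntangled (d : ℕ) :
    (EuclideanSpace ℂ (Fin d) ⊗[ℂ] EuclideanSpace ℂ (Fin d)) ⊗[ℂ]
      (EuclideanSpace ℂ (Fin d) ⊗[ℂ] EuclideanSpace ℂ (Fin d)) :=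
  (d : ℂ)⁻¹ • ∑ i : Fin d, ∑ j : Fin d,
    (EuclideanSpace.single i (1 : ℂ) ⊗ₜ[ℂ] EuclideanSpace.single j (1 : ℂ)) ⊗ₜ[ℂ]
      (EuclideanSpace.single i (1 : ℂ) ⊗ₜ[ℂ] EuclideanSpace.single j (1 : ℂ))

variable {X Y : Type*} [NormedAddCommGroup X] [InnerProductSpace ℂ X] [FiniteDimensional ℂ X]
  [NormedAddCommGroup Y] [InnerProductSpace ℂ Y] [FiniteDimensional ℂ Y]

/-- The Choi–Jamiolkowski vector `(V ⊗ id) |MAX⟩` of the code restricted to the regulated code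
subspace. -/
def choiVector {N : VonNeumannAlgebra H} {Ω : H} (B : Bipartition N Ω) (V : H →L[ℂ] X ⊗[ℂ] Y) :
    (X ⊗[ℂ] Y) ⊗[ℂ] (EuclideanSpace ℂ (Fin B.d) ⊗[ℂ] EuclideanSpace ℂ (Fin B.d)) :=
  LinearMap.rTensor _
    (V.toLinearMap ∘ₗ (regSpace N Ω).subtype ∘ₗ B.Φ.toLinearEquiv.toLinearMap)
    (maxEntangled B.d)

/-- The entropy of the Choi–Jamiolkowski vector on `B(X) ⊗ B(K_Lʳᵉᶠ) = B(X ⊗ K_Lʳᵉᶠ)`. -/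
def choiEntropy {N : VonNeumannAlgebra H} {Ω : H} (B : Bipartition N Ω)
    (V : H →L[ℂ] X ⊗[ℂ] Y) : ℝ :=
  leftEntropy (TensorProduct.tensorTensorTensorComm ℂ X Y
    (EuclideanSpace ℂ (Fin B.d)) (EuclideanSpace ℂ (Fin B.d)) (choiVector B V))

open Classical in
/-- The area term of the left region, for the code `V` restricted to the regulated code subspace of
`N`. (It does not depend on the bipartition; a bipartition exists when `N` is a finite-dimensional
factor with separating vector `Ω`.) -/
def areaTerm (N : VonNeumannAlgebra H) (Ω : H) (V : H →L[ℂ] X ⊗[ℂ] Y) : ℝ :=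
  if h : Nonempty (Bipartition N Ω) then choiEntropy h.some V else 0

/-- Reconstruction of the unitaries of the regulated algebra on the state `ψ` up to error `δ`: for
all `Ûᴸ, Ûᴿ` there are boundary unitaries `Ũᴸ` (a measurable function of `Uᴸ`) and `Ũᴿ` (a
measurable function of `Uᴿ`) with `‖V Uᴿ Uᴸ ψ - Ũᴿ Ũᴸ V Ûᴿ Ûᴸ ψ‖ ≤ δ` for all `Uᴸ, Uᴿ`. -/
def Reconstructs [CompleteSpace X] [CompleteSpace Y] (N : VonNeumannAlgebra H) (Ω : H)
    (V : H →L[ℂ] X ⊗[ℂ] Y) (ψ : regSpace N Ω) (δ : ℝ) : Prop :=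
  ∀ (hatUL : LeftUnitary N) (hatUR : RightUnitary N Ω),
    ∃ (tildeUL : LeftUnitary N → unitary (X →L[ℂ] X))
      (tildeUR : RightUnitary N Ω → unitary (Y →L[ℂ] Y)),
      @Measurable _ _ (borel _) (borel _) tildeUL ∧ @Measurable _ _ (borel _) (borel _) tildeUR ∧
      ∀ (UL : LeftUnitary N) (UR : RightUnitary N Ω),
        ‖V (act UL UR ψ) -
          TensorProduct.map (tildeUL UL).1.toLinearMap (tildeUR UR).1.toLinearMap
            (V (act hatUL hatUR ψ))‖ ≤ δ

end Operators

/-- A code subspace renormalization scheme, in its GNS representation: the factor `M` acts on `H`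
with a cyclic and separating unit vector `Ω`, and the faithful normal state is
`ω = ⟨Ω, · Ω⟩`. -/
structure RenormalizationScheme (Λ : Type*) [PartialOrder Λ] (H : Type*) [NormedAddCommGroup H]
    [InnerProductSpace ℂ H] [CompleteSpace H] where
  /-- the large `N` algebra -/
  M : VonNeumannAlgebra H
  isFactor : IsFactor M
  /-- the GNS vector -/
  Ω : H
  norm_Ω : ‖Ω‖ = 1
  cyclic : Dense {v : H | ∃ x ∈ M, v = x Ω}
  separating : ∀ x ∈ M, x Ω = 0 → x = 0
  /-- the regulated algebras `M_lam` -/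
  sub : Λ → VonNeumannAlgebra H
  sub_le : ∀ lam, sub lam ≤ M
  sub_mono : ∀ {lam mu}, mu ≤ lam → sub mu ≤ sub lam
  sub_typeI : ∀ lam, IsTypeIFactor (sub lam)
  /-- the conditional expectations of `M` onto `M_lam` -/
  toSub : ∀ lam, M.toStarSubalgebra →ₗ[ℂ] (sub lam).toStarSubalgebra
  toSub_condExp : ∀ lam, IsFaithfulNormalCondExp M (sub lam) (sub_le lam) (toSub lam)
  /-- the conditional expectations of `M_lam` onto `M_mu`, for `mu ≤ lam` -/
  flow : ∀ {lam mu}, mu ≤ lam → ((sub lam).toStarSubalgebra →ₗ[ℂ] (sub mu).toStarSubalgebra)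
  flow_condExp : ∀ {lam mu} (h : mu ≤ lam),
    IsFaithfulNormalCondExp (sub lam) (sub mu) (sub_mono h) (flow h)
  flow_comp_toSub : ∀ {lam mu} (h : mu ≤ lam), toSub mu = flow h ∘ₗ toSub lam
  flow_comp_flow : ∀ {lam mu nu} (h : mu ≤ lam) (h' : nu ≤ mu),
    flow (h'.trans h) = flow h' ∘ₗ flow h
  invariant : ∀ lam (x : M.toStarSubalgebra),
    inner ℂ Ω ((toSub lam x : H →L[ℂ] H) Ω) = inner ℂ Ω ((x : H →L[ℂ] H) Ω)

namespace RenormalizationScheme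

variable {Λ : Type*} [PartialOrder Λ] {H : Type*} [NormedAddCommGroup H]
  [InnerProductSpace ℂ H] [CompleteSpace H] (C : RenormalizationScheme Λ H)

/-- The regulated code subspace `H_lam`. -/
abbrev space (lam : Λ) : Submodule ℂ H := regSpace (C.sub lam) C.Ω

/-- For `mu ≤ lam`, a vector of `H_mu` seen in `H_lam`. -/
def incl {lam mu : Λ} (h : mu ≤ lam) (ψ : C.space mu) : C.space lam :=
  ⟨ψ, regSpace_mono (C.sub_mono h) C.Ω ψ.2⟩

/-- The complementary factor `M_{lam mu}` in `M_lam = M_mu ⊗ M_{lam mu}`, that is, the relative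
commutant of `M_mu` in `M_lam`. -/
def between (lam mu : Λ) : StarSubalgebra ℂ (H →L[ℂ] H) :=
  (C.sub lam).toStarSubalgebra ⊓ (C.sub mu).commutant.toStarSubalgebra

end RenormalizationScheme

end LargeNCode

end

/-! The heart is an exact identity between finite matrices. Let (U α) be d² unitaries of the d × d
matrices, orthogonal for the trace, and let ψ be the state. Take the Choi vector of the code
together with a separate copy of ψ. The coefficients d^(-1/2) (U α)ₓ form a unitary matrix on ℂᵈ ⊗
ℂᵈ. Applying it to the pair (reference leg, leg of ψ), once on the left and once on the right,
leaves the left-right entropy unchanged and produces d⁻² ∑ V(U α ⊗ U β)ψ ⊗ |α⟩|β⟩, summed over all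
α, β.

Reconstruction replaces V(U α ⊗ U β)ψ by (S α ⊗ T β)Vψ up to δ. The vector so obtained is Vψ times a
product vector, acted on by unitaries of the two sides controlled by the labels, so its entropy is
that of Vψ. Hence A + ‖Choi‖² S(ψ) ≈ S(Vψ), where A is the area term. The same comparison puts
‖Choi‖² within 2δ of ‖Vψ‖², which tends to 1, so the weight can be dropped. This is
`entropy_choiMatrix_add`. The price is a Fannes-type modulus of order δ log dim + √δ
(`abs_bipartiteEntropy_sub_le`), which vanishes because δ decays superpolynomially and log dim grows
polynomially.

The formula is used twice for the same Ψ. For M_mu, its right unitaries must be reconstructible: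
they are right multiplications by elements of M_mu, and invariance of the state under the
conditional expectation lets the same multiplications act isometrically on H_lam
(`exists_extend_rightUnitary`). For M_lam, the conditional expectation onto M_mu sends the relative
commutant to scalars, so Ψ is a product state and S(Ψ, M_lam) splits (`vectorEntropy_sub_eq_add`). A
further use of reconstruction shows that the rotations Û change S(VΨ) negligibly. Comparing the two
formulas gives the relation between the areas.

The remaining work passes between operator algebras and matrices: a finite-dimensional type I factor
has matrix units, these yield a bipartition of the regulated space, and by Skolem–Noether the
entropy does not depend on the identification chosen. -/

noncomputable section

namespace LargeNCode

open Matrix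
open scoped Kronecker

/-! ### Entropy of coefficient matrices and its continuity. -/

section SpectralEntropy

variable {ι κ : Type*} [Fintype ι] [Fintype κ]

/-- `∑ -z log z` over the eigenvalues `z` of a matrix with an arbitrary finite index type. -/
def spectralEntropy [DecidableEq ι] (ρ : Matrix ι ι ℂ) : ℝ :=
  (ρ.charpoly.roots.map fun z => Real.negMulLog z.re).sum

theorem spectralEntropy_mul_comm [DecidableEq ι] (A B : Matrix ι ι ℂ) :
    spectralEntropy (A * B) = spectralEntropy (B * A) := by
  simp only [spectralEntropy, Matrix.charpoly_mul_comm]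

theorem spectralEntropy_submatrix_equiv [DecidableEq ι] [DecidableEq κ] (e : κ ≃ ι)
    (ρ : Matrix ι ι ℂ) : spectralEntropy (ρ.submatrix e e) = spectralEntropy ρ := by
  have := Matrix.charpoly_reindex e.symm ρ
  simp only [Matrix.reindex_apply, Equiv.symm_symm] at this
  simp only [spectralEntropy, this]

theorem spectralEntropy_diagonal [DecidableEq ι] (f : ι → ℂ) :
    spectralEntropy (diagonal f) = ∑ i, Real.negMulLog (f i).re := by
  have h : ∏ i, (Polynomial.X - Polynomial.C (f i)) =
      ((Finset.univ.val.map f).map fun a => Polynomial.X - Polynomial.C a).prod := by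
    rw [Multiset.map_map]; rfl
  rw [spectralEntropy, Matrix.charpoly_diagonal, h, Polynomial.roots_multiset_prod_X_sub_C]
  simp

/-- The squared Hilbert–Schmidt norm. -/
def hsSq (A : Matrix ι κ ℂ) : ℝ := ∑ i, ∑ j, ‖A i j‖ ^ 2

omit [Fintype ι] in
theorem mul_conjTranspose_self_apply_self (A : Matrix ι κ ℂ) (i : ι) :
    (A * Aᴴ) i i = ((∑ j, ‖A i j‖ ^ 2 : ℝ) : ℂ) := by
  simp [Matrix.mul_apply, Complex.mul_conj, Complex.normSq_eq_norm_sq]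

theorem trace_mul_conjTranspose_self (A : Matrix ι κ ℂ) : (A * Aᴴ).trace = (hsSq A : ℂ) := by
  simp only [Matrix.trace, Matrix.diag_apply, mul_conjTranspose_self_apply_self, hsSq]
  push_cast; rfl

theorem hsSq_unitary_mul [DecidableEq ι] (A : Matrix ι κ ℂ) (U : Matrix ι ι ℂ) (hU : Uᴴ * U = 1) :
    hsSq (U * A) = hsSq A := by
  have h : ((hsSq (U * A) : ℝ) : ℂ) = (hsSq A : ℝ) := by
    rw [← trace_mul_conjTranspose_self, ← trace_mul_conjTranspose_self, conjTranspose_mul,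
      Matrix.trace_mul_comm, Matrix.mul_assoc, ← Matrix.mul_assoc Uᴴ, hU, Matrix.one_mul,
      Matrix.trace_mul_comm]
  exact_mod_cast h

theorem hsSq_mul_unitary [DecidableEq κ] (A : Matrix ι κ ℂ) (U : Matrix κ κ ℂ) (hU : U * Uᴴ = 1) :
    hsSq (A * U) = hsSq A := by
  have h : ((hsSq (A * U) : ℝ) : ℂ) = (hsSq A : ℝ) := by
    rw [← trace_mul_conjTranspose_self, ← trace_mul_conjTranspose_self, conjTranspose_mul,
      Matrix.mul_assoc, ← Matrix.mul_assoc U, hU, Matrix.one_mul]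
  exact_mod_cast h

/-- The entropy of the left reduced density matrix of the bipartite vector with coefficients `A`. -/
def bipartiteEntropy [DecidableEq ι] (A : Matrix ι κ ℂ) : ℝ := spectralEntropy (A * Aᴴ)

theorem bipartiteEntropy_unitary_mul_mul [DecidableEq ι] [DecidableEq κ] (A : Matrix ι κ ℂ)
    (U : Matrix ι ι ℂ) (W : Matrix κ κ ℂ) (hU : Uᴴ * U = 1) (hW : W * Wᴴ = 1) :
    bipartiteEntropy (U * A * W) = bipartiteEntropy A := by
  have : U * A * W * (U * A * W)ᴴ = U * (A * Aᴴ * Uᴴ) := by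
    simp only [conjTranspose_mul, Matrix.mul_assoc]
    rw [← Matrix.mul_assoc W, hW, Matrix.one_mul]
  rw [bipartiteEntropy, this, spectralEntropy_mul_comm, Matrix.mul_assoc, hU, Matrix.mul_one,
    bipartiteEntropy]

theorem bipartiteEntropy_submatrix_equiv [DecidableEq ι] {ι' κ' : Type*} [Fintype ι'] [Fintype κ']
    [DecidableEq ι'] (e : ι' ≃ ι) (f : κ' ≃ κ) (A : Matrix ι κ ℂ) :
    bipartiteEntropy (A.submatrix e f) = bipartiteEntropy A := by
  rw [bipartiteEntropy, conjTranspose_submatrix, Matrix.submatrix_mul_equiv,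
    spectralEntropy_submatrix_equiv, bipartiteEntropy]

-- Reduces entropy estimates to the eigenvalues of the positive matrix A Aᴴ: a nonnegative finite
-- sequence of total mass the squared norm of A, possibly below 1.
open scoped ComplexOrder in
theorem exists_diagonalization [DecidableEq ι] (A : Matrix ι κ ℂ) :
    ∃ (U : Matrix ι ι ℂ) (p : ι → ℝ), Uᴴ * U = 1 ∧ U * Uᴴ = 1 ∧ (∀ i, 0 ≤ p i) ∧
      A * Aᴴ = U * diagonal (fun i => (p i : ℂ)) * Uᴴ ∧
      bipartiteEntropy A = ∑ i, Real.negMulLog (p i) ∧ ∑ i, p i = hsSq A := by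
  have hA : (A * Aᴴ).IsHermitian := isHermitian_mul_conjTranspose_self A
  have hU := hA.eigenvectorUnitary.2
  have h1 : (hA.eigenvectorUnitary : Matrix ι ι ℂ)ᴴ * hA.eigenvectorUnitary = 1 :=
    (Matrix.mem_unitaryGroup_iff'.1 hU)
  have h2 : (hA.eigenvectorUnitary : Matrix ι ι ℂ) * (hA.eigenvectorUnitary : Matrix ι ι ℂ)ᴴ = 1 :=
    (Matrix.mem_unitaryGroup_iff.1 hU)
  refine ⟨hA.eigenvectorUnitary, hA.eigenvalues, h1, h2, ?_, ?_, ?_, ?_⟩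
  · exact fun i => (posSemidef_self_mul_conjTranspose A).eigenvalues_nonneg i
  · conv_lhs => rw [hA.spectral_theorem]
    rfl
  · rw [bipartiteEntropy, spectralEntropy, hA.roots_charpoly_eq_eigenvalues]
    simp
  · have := hA.trace_eq_sum_eigenvalues
    rw [trace_mul_conjTranspose_self] at this
    refine Complex.ofReal_injective ?_
    rw [this]
    push_cast
    rfl

theorem bipartiteEntropy_eq_of_diagonal [DecidableEq ι] (A : Matrix ι κ ℂ) (U : Matrix ι ι ℂ)
    (p : ι → ℝ) (hU : Uᴴ * U = 1) (h : A * Aᴴ = U * diagonal (fun i => (p i : ℂ)) * Uᴴ) :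
    bipartiteEntropy A = ∑ i, Real.negMulLog (p i) := by
  rw [bipartiteEntropy, h, spectralEntropy_mul_comm, ← Matrix.mul_assoc, hU, Matrix.one_mul,
    spectralEntropy_diagonal]
  simp

theorem sum_normSq_row_eq_one [DecidableEq ι] (U : Matrix ι ι ℂ) (hU : U * Uᴴ = 1) (i : ι) :
    ∑ k, ‖U i k‖ ^ 2 = 1 := by
  have := mul_conjTranspose_self_apply_self U i
  rw [hU, one_apply_eq] at this
  exact_mod_cast this.symm

/-- The entropy of a density matrix is at most the Shannon entropy of its diagonal. -/
theorem bipartiteEntropy_le_sum_negMulLog [DecidableEq ι] (A : Matrix ι κ ℂ) :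
    bipartiteEntropy A ≤ ∑ i, Real.negMulLog (∑ j, ‖A i j‖ ^ 2) := by
  obtain ⟨U, p, hU, hU', hp, hA, hS, -⟩ := exists_diagonalization A
  -- The diagonal of A Aᴴ is the image of its spectrum under the doubly stochastic matrix ‖U i k‖².
  -- Rows supply the Jensen weights, columns keep the total.
  have hd : ∀ i, ∑ j, ‖A i j‖ ^ 2 = ∑ k, ‖U i k‖ ^ 2 * p k := by
    intro i
    have h1 := mul_conjTranspose_self_apply_self A i
    rw [hA, Matrix.mul_apply] at h1
    simp only [mul_diagonal, conjTranspose_apply, RCLike.star_def] at h1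
    have h2 : ∀ k, U i k * (p k : ℂ) * (starRingEnd ℂ) (U i k) = ((‖U i k‖ ^ 2 * p k : ℝ) : ℂ) := by
      intro k
      rw [mul_right_comm, Complex.mul_conj, Complex.normSq_eq_norm_sq]
      push_cast; ring
    simp only [h2] at h1
    exact_mod_cast h1.symm
  have hcol : ∀ k, ∑ i, ‖U i k‖ ^ 2 = 1 := by
    intro k
    have := sum_normSq_row_eq_one Uᴴ (by simpa using hU) k
    simpa using this
  calc bipartiteEntropy A = ∑ k, Real.negMulLog (p k) := hS
    _ = ∑ k, ∑ i, ‖U i k‖ ^ 2 * Real.negMulLog (p k) := by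
      refine Finset.sum_congr rfl fun k _ => ?_
      rw [← Finset.sum_mul, hcol, one_mul]
    _ = ∑ i, ∑ k, ‖U i k‖ ^ 2 * Real.negMulLog (p k) := Finset.sum_comm
    _ ≤ _ := by
      refine Finset.sum_le_sum fun i _ => ?_
      rw [hd]
      have := Real.concaveOn_negMulLog.le_map_sum (t := Finset.univ) (w := fun k => ‖U i k‖ ^ 2)
        (p := p) (fun k _ => sq_nonneg _) (sum_normSq_row_eq_one U hU' i) (fun k _ => hp k)
      simpa using this

/-- For q ≤ p this is subadditivity of -x log x; for p ≤ q it follows from log x ≤ x - 1 at x = q /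
p. The extra linear term on the right makes it unnecessary to assume |p - q| small. -/
theorem negMulLog_sub_le {p q : ℝ} (hp : 0 ≤ p) (hp1 : p ≤ 1) (hq : 0 ≤ q) (hq1 : q ≤ 1) :
    Real.negMulLog p - Real.negMulLog q ≤ Real.negMulLog |p - q| + |p - q| := by
  have key : ∀ {a b : ℝ}, 0 ≤ a → 0 ≤ b →
      Real.negMulLog (a + b) ≤ Real.negMulLog a + Real.negMulLog b := by
    intro a b ha hb
    rcases ha.eq_or_lt with rfl | ha
    · simp
    rcases hb.eq_or_lt with rfl | hb
    · simp
    have h1 := Real.log_le_log ha (le_add_of_nonneg_right hb.le)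
    have h2 := Real.log_le_log hb (le_add_of_nonneg_left ha.le)
    simp only [Real.negMulLog]
    nlinarith
  rcases le_total q p with h | h
  · rw [abs_of_nonneg (sub_nonneg.2 h)]
    have := key hq (sub_nonneg.2 h)
    rw [add_sub_cancel] at this
    linarith
  · rw [abs_of_nonpos (sub_nonpos.2 h)]
    have h0 : 0 ≤ Real.negMulLog (-(p - q)) :=
      Real.negMulLog_nonneg (by linarith) (by linarith)
    suffices h1 : Real.negMulLog p - Real.negMulLog q ≤ q - p by linarith
    rcases hp.eq_or_lt with rfl | hp
    · simp only [Real.negMulLog_zero, zero_sub, sub_zero]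
      have := Real.negMulLog_nonneg hq hq1
      linarith
    · have h2 : Real.log q - Real.log p ≤ q / p - 1 := by
        rw [← Real.log_div (by linarith) hp.ne']
        exact Real.log_le_sub_one_of_pos (div_pos (by linarith) hp)
      have h3 : p * (Real.log q - Real.log p) ≤ q - p := by
        have := mul_le_mul_of_nonneg_left h2 hp.le
        rwa [mul_sub p (q / p), mul_div_cancel₀ _ hp.ne', mul_one] at this
      have h4 : (q - p) * Real.log q ≤ 0 :=
        mul_nonpos_of_nonneg_of_nonpos (by linarith) (Real.log_nonpos hq hq1)
      simp only [Real.negMulLog]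
      nlinarith

/-- The inequality log s ≤ s - 1 at s = 1/√t. Unlike -t log t, the bound is monotone, so an upper
bound on t can be inserted. -/
theorem negMulLog_le_two_mul_sqrt {t : ℝ} (ht : 0 ≤ t) : Real.negMulLog t ≤ 2 * √t := by
  rcases ht.eq_or_lt with rfl | ht
  · simp
  have hs := Real.sqrt_pos.2 ht
  have h := Real.log_le_sub_one_of_pos (inv_pos.2 hs)
  rw [Real.log_inv, Real.log_sqrt ht.le] at h
  have h1 := mul_le_mul_of_nonneg_left h ht.le
  have h2 : t * (√t)⁻¹ = √t := by
    rw [← div_eq_mul_inv, Real.div_sqrt]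
  rw [mul_sub, h2] at h1
  simp only [Real.negMulLog]
  linarith

/-- Jensen with uniform weights; the last term accounts for a total mass different from 1. -/
theorem sum_negMulLog_le (t : ι → ℝ) (ht : ∀ i, 0 ≤ t i) :
    ∑ i, Real.negMulLog (t i) ≤
      (∑ i, t i) * Real.log (Fintype.card ι) + Real.negMulLog (∑ i, t i) := by
  cases isEmpty_or_nonempty ι
  · simp
  have hn : (0 : ℝ) < Fintype.card ι := by exact_mod_cast Fintype.card_pos
  have := Real.concaveOn_negMulLog.le_map_sum (t := Finset.univ)
    (w := fun _ : ι => (Fintype.card ι : ℝ)⁻¹) (p := t) (fun _ _ => by positivity)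
    (by simp [hn.ne']) (fun i _ => ht i)
  simp only [smul_eq_mul, ← Finset.mul_sum] at this
  rw [Real.negMulLog_mul] at this
  have h2 := mul_le_mul_of_nonneg_left this hn.le
  rw [← mul_assoc, mul_inv_cancel₀ hn.ne', one_mul, mul_add, mul_inv_cancel_left₀ hn.ne'] at h2
  refine h2.trans (le_of_eq ?_)
  simp only [Real.negMulLog, Real.log_inv]
  field_simp

theorem bipartiteEntropy_nonneg [DecidableEq ι] (A : Matrix ι κ ℂ) (hA : hsSq A ≤ 1) :
    0 ≤ bipartiteEntropy A := by
  obtain ⟨U, p, -, -, hp, -, hS, hs⟩ := exists_diagonalization A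
  rw [hS]
  refine Finset.sum_nonneg fun i _ => Real.negMulLog_nonneg (hp i) ?_
  exact (Finset.single_le_sum (fun i _ => hp i) (Finset.mem_univ i)).trans (hs.trans_le hA)

theorem bipartiteEntropy_le_log [DecidableEq ι] (A : Matrix ι κ ℂ) (hA : hsSq A = 1) :
    bipartiteEntropy A ≤ Real.log (Fintype.card ι) := by
  obtain ⟨U, p, -, -, hp, -, hS, hs⟩ := exists_diagonalization A
  have := sum_negMulLog_le p hp
  rw [hS]
  rw [hs, hA] at this
  simpa using this

/-- Cauchy–Schwarz applied to |a|² - |b|² = (|a| - |b|)(|a| + |b|), the second factor having squared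
sum at most 4. -/
theorem sum_abs_row_sub_le (A B : Matrix ι κ ℂ) (hA : hsSq A ≤ 1) (hB : hsSq B ≤ 1) {δ : ℝ}
    (hδ : 0 ≤ δ) (h : hsSq (A - B) ≤ δ ^ 2) :
    ∑ i, |∑ j, ‖A i j‖ ^ 2 - ∑ j, ‖B i j‖ ^ 2| ≤ 2 * δ := by
  have h1 : ∀ i, |∑ j, ‖A i j‖ ^ 2 - ∑ j, ‖B i j‖ ^ 2| ≤
      ∑ j, ‖(A - B) i j‖ * (‖A i j‖ + ‖B i j‖) := by
    intro i
    rw [← Finset.sum_sub_distrib]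
    refine (Finset.abs_sum_le_sum_abs _ _).trans (Finset.sum_le_sum fun j _ => ?_)
    rw [sq_sub_sq, abs_mul, mul_comm, abs_of_nonneg (by positivity : 0 ≤ ‖A i j‖ + ‖B i j‖)]
    exact mul_le_mul_of_nonneg_right (abs_norm_sub_norm_le _ _) (by positivity)
  refine (Finset.sum_le_sum fun i _ => h1 i).trans ?_
  have h2 := Finset.sum_mul_sq_le_sq_mul_sq (Finset.univ : Finset (ι × κ))
    (fun x => ‖(A - B) x.1 x.2‖) (fun x => ‖A x.1 x.2‖ + ‖B x.1 x.2‖)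
  simp only [Fintype.sum_prod_type] at h2
  have h3 : ∑ i, ∑ j, (‖A i j‖ + ‖B i j‖) ^ 2 ≤ 4 := by
    calc ∑ i, ∑ j, (‖A i j‖ + ‖B i j‖) ^ 2
        ≤ ∑ i, ∑ j, (2 * ‖A i j‖ ^ 2 + 2 * ‖B i j‖ ^ 2) :=
          Finset.sum_le_sum fun i _ => Finset.sum_le_sum fun j _ => by
            nlinarith [sq_nonneg (‖A i j‖ - ‖B i j‖)]
      _ = 2 * hsSq A + 2 * hsSq B := by
          simp only [Finset.sum_add_distrib, ← Finset.mul_sum, hsSq]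
      _ ≤ 4 := by linarith
  refine abs_le_of_sq_le_sq' (h2.trans ?_) (by positivity) |>.2
  have h4 : 0 ≤ ∑ i, ∑ j, (‖A i j‖ + ‖B i j‖) ^ 2 :=
    Finset.sum_nonneg fun i _ => Finset.sum_nonneg fun j _ => sq_nonneg _
  calc _ ≤ δ ^ 2 * 4 := mul_le_mul h h3 h4 (sq_nonneg _)
    _ = _ := by ring

/-- Modulus of continuity of the entropy of subnormalized vectors, for a left factor of dimension
`n`. -/
def entropyModulus (n : ℕ) (δ : ℝ) : ℝ := 2 * δ * Real.log n + (2 * √(2 * δ) + 2 * δ)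

/-- A Fannes-type inequality. In the eigenbasis of B Bᴴ the entropy of B is the Shannon entropy of
the diagonal, and that of A is at most the Shannon entropy of its own diagonal, so only two
classical distributions have to be compared. One direction suffices, the other following by
exchanging A and B. -/
theorem bipartiteEntropy_sub_le [DecidableEq ι] (A B : Matrix ι κ ℂ) (hA : hsSq A ≤ 1)
    (hB : hsSq B ≤ 1) {δ : ℝ} (hδ : 0 ≤ δ) (h : hsSq (A - B) ≤ δ ^ 2) :
    bipartiteEntropy A - bipartiteEntropy B ≤ entropyModulus (Fintype.card ι) δ := by
  classical
  obtain ⟨U, q, hU, hU', hq, hBq, hSB, hsB⟩ := exists_diagonalization B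
  have hU'' : Uᴴᴴ * Uᴴ = 1 := by simpa using hU'
  set A' := Uᴴ * A with hA'
  set B' := Uᴴ * B with hB'
  have hSA : bipartiteEntropy A' = bipartiteEntropy A := by
    have := bipartiteEntropy_unitary_mul_mul A Uᴴ 1 hU'' (by simp)
    rwa [Matrix.mul_one] at this
  have hA1 : hsSq A' ≤ 1 := by rwa [hA', hsSq_unitary_mul _ _ hU'']
  have hB1 : hsSq B' ≤ 1 := by rwa [hB', hsSq_unitary_mul _ _ hU'']
  have hAB : hsSq (A' - B') ≤ δ ^ 2 := by
    rwa [hA', hB', ← Matrix.mul_sub, hsSq_unitary_mul _ _ hU'']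
  have hqrow : ∀ i, ∑ j, ‖B' i j‖ ^ 2 = q i := by
    intro i
    have h1 := mul_conjTranspose_self_apply_self B' i
    have h2 : B' * B'ᴴ = diagonal fun i => (q i : ℂ) := by
      rw [hB', conjTranspose_mul, conjTranspose_conjTranspose, Matrix.mul_assoc,
        ← Matrix.mul_assoc B, hBq, ← Matrix.mul_assoc, ← Matrix.mul_assoc, ← Matrix.mul_assoc, hU,
        Matrix.one_mul, Matrix.mul_assoc, hU, Matrix.mul_one]
    rw [h2, diagonal_apply_eq] at h1
    exact_mod_cast h1.symm
  have hrow : ∀ (C : Matrix ι κ ℂ), hsSq C ≤ 1 → ∀ i, ∑ j, ‖C i j‖ ^ 2 ≤ 1 := fun C hC i =>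
    (Finset.single_le_sum (f := fun i => ∑ j, ‖C i j‖ ^ 2)
      (fun i _ => Finset.sum_nonneg fun _ _ => sq_nonneg _) (Finset.mem_univ i)).trans hC
  set t : ι → ℝ := fun i => |∑ j, ‖A' i j‖ ^ 2 - ∑ j, ‖B' i j‖ ^ 2| with ht
  have hT : ∑ i, t i ≤ 2 * δ := sum_abs_row_sub_le A' B' hA1 hB1 hδ hAB
  have hT0 : 0 ≤ ∑ i, t i := Finset.sum_nonneg fun _ _ => abs_nonneg _
  have hlog : 0 ≤ Real.log (Fintype.card ι) := Real.log_natCast_nonneg _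
  calc bipartiteEntropy A - bipartiteEntropy B
      ≤ ∑ i, (Real.negMulLog (∑ j, ‖A' i j‖ ^ 2) - Real.negMulLog (∑ j, ‖B' i j‖ ^ 2)) := by
        rw [← hSA, hSB, Finset.sum_sub_distrib]
        simp only [hqrow]
        exact sub_le_sub_right (bipartiteEntropy_le_sum_negMulLog A') _
    _ ≤ ∑ i, (Real.negMulLog (t i) + t i) := Finset.sum_le_sum fun i _ =>
        negMulLog_sub_le (Finset.sum_nonneg fun _ _ => sq_nonneg _) (hrow A' hA1 i)
          (Finset.sum_nonneg fun _ _ => sq_nonneg _) (hrow B' hB1 i)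
    _ = ∑ i, Real.negMulLog (t i) + ∑ i, t i := Finset.sum_add_distrib
    _ ≤ ((∑ i, t i) * Real.log (Fintype.card ι) + Real.negMulLog (∑ i, t i)) + ∑ i, t i :=
        add_le_add_left (sum_negMulLog_le t fun _ => abs_nonneg _) _
    -- With T = ∑ t i ≤ 2δ, the terms of the modulus bound T log n, -T log T ≤ 2√T, and T.
    _ ≤ entropyModulus (Fintype.card ι) δ := by
        have h1 := mul_le_mul_of_nonneg_right hT hlog
        have h2 := negMulLog_le_two_mul_sqrt hT0
        have h3 := Real.sqrt_le_sqrt hT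
        simp only [entropyModulus]
        linarith

theorem hsSq_sub_comm (A B : Matrix ι κ ℂ) : hsSq (A - B) = hsSq (B - A) := by
  simp only [hsSq, Matrix.sub_apply, norm_sub_rev]

theorem abs_bipartiteEntropy_sub_le [DecidableEq ι] (A B : Matrix ι κ ℂ) (hA : hsSq A ≤ 1)
    (hB : hsSq B ≤ 1) {δ : ℝ} (hδ : 0 ≤ δ) (h : hsSq (A - B) ≤ δ ^ 2) :
    |bipartiteEntropy A - bipartiteEntropy B| ≤ entropyModulus (Fintype.card ι) δ :=
  abs_sub_le_iff.2 ⟨bipartiteEntropy_sub_le A B hA hB hδ h,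
    bipartiteEntropy_sub_le B A hB hA hδ (hsSq_sub_comm A B ▸ h)⟩

theorem hsSq_kronecker {ι' κ' : Type*} [Fintype ι'] [Fintype κ'] (A : Matrix ι κ ℂ)
    (B : Matrix ι' κ' ℂ) : hsSq (A ⊗ₖ B) = hsSq A * hsSq B := by
  have h : ((hsSq (A ⊗ₖ B) : ℝ) : ℂ) = ((hsSq A * hsSq B : ℝ) : ℂ) := by
    rw [← trace_mul_conjTranspose_self, conjTranspose_kronecker, ← mul_kronecker_mul,
      trace_kronecker, trace_mul_conjTranspose_self, trace_mul_conjTranspose_self]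
    push_cast; rfl
  exact_mod_cast h

/-- The spectrum consists of the products p q, and -x log x is a derivation on products. The squared
norms appear as weights because the vectors may be subnormalized. -/
theorem bipartiteEntropy_kronecker [DecidableEq ι] {ι' κ' : Type*} [Fintype ι'] [Fintype κ']
    [DecidableEq ι'] (A : Matrix ι κ ℂ) (B : Matrix ι' κ' ℂ) :
    bipartiteEntropy (A ⊗ₖ B) = hsSq B * bipartiteEntropy A + hsSq A * bipartiteEntropy B := by
  obtain ⟨U, p, hU, -, -, hA, hSA, hsA⟩ := exists_diagonalization A
  obtain ⟨W, q, hW, -, -, hB, hSB, hsB⟩ := exists_diagonalization B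
  have h : (A ⊗ₖ B) * (A ⊗ₖ B)ᴴ =
      (U ⊗ₖ W) * diagonal (fun x : ι × ι' => ((p x.1 * q x.2 : ℝ) : ℂ)) * (U ⊗ₖ W)ᴴ := by
    rw [conjTranspose_kronecker, ← mul_kronecker_mul, hA, hB, mul_kronecker_mul, mul_kronecker_mul,
      diagonal_kronecker_diagonal, conjTranspose_kronecker]
    simp
  have hUW : (U ⊗ₖ W)ᴴ * (U ⊗ₖ W) = 1 := by
    rw [conjTranspose_kronecker, ← mul_kronecker_mul, hU, hW, one_kronecker_one]
  rw [bipartiteEntropy_eq_of_diagonal _ _ _ hUW h, hSA, hSB, ← hsA, ← hsB]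
  simp only [Real.negMulLog_mul, Fintype.sum_prod_type, Finset.sum_add_distrib, Finset.sum_mul,
    Finset.mul_sum]
  congr 1
  rw [Finset.sum_comm]

theorem dotProduct_star_self_eq_one (c : ι → ℂ) (hc : ∑ i, ‖c i‖ ^ 2 = 1) : c ⬝ᵥ star c = 1 := by
  simp only [dotProduct, Pi.star_apply, RCLike.star_def, Complex.mul_conj,
    Complex.normSq_eq_norm_sq]
  exact_mod_cast hc

theorem bipartiteEntropy_vecMulVec [DecidableEq ι] (a : ι → ℂ) (b : κ → ℂ)
    (ha : ∑ i, ‖a i‖ ^ 2 = 1) (hb : ∑ i, ‖b i‖ ^ 2 = 1) : bipartiteEntropy (vecMulVec a b) = 0 := by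
  have h : vecMulVec a b * (vecMulVec a b)ᴴ = vecMulVec a (star a) := by
    rw [conjTranspose_vecMulVec, vecMulVec_mul_vecMulVec, dotProduct_star_self_eq_one b hb]
    simp
  have hι : Nonempty ι := by
    by_contra hne
    rw [not_nonempty_iff] at hne
    simp at ha
  rw [bipartiteEntropy, spectralEntropy, h, charpoly_vecMulVec, dotProduct_star_self_eq_one a ha, one_smul]
  obtain ⟨n, hn⟩ : ∃ n, Fintype.card ι = n + 1 := ⟨_, (Nat.succ_pred_eq_of_pos Fintype.card_pos).symm⟩
  -- A rank-one projection: one eigenvalue 1 and the rest 0, all contributing 0 to the entropy.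
  have hfac : (Polynomial.X ^ (n + 1) - Polynomial.X ^ n : Polynomial ℂ) =
      Polynomial.X ^ n * (Polynomial.X - Polynomial.C 1) := by
    rw [Polynomial.C_1]; ring
  rw [hn, Nat.add_sub_cancel, hfac, Polynomial.roots_mul, Polynomial.roots_X_pow,
    Polynomial.roots_X_sub_C]
  · simp [Multiset.map_nsmul, Multiset.sum_nsmul]
  · exact mul_ne_zero (pow_ne_zero _ Polynomial.X_ne_zero) (Polynomial.X_sub_C_ne_zero _)

end SpectralEntropy

/-! ### Matrix units and independence of the entropy from the identification. -/

section MatrixUnits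

variable {A : Type*} [Ring A] [Algebra ℂ A] [StarRing A] {ι : Type*} [Fintype ι] [DecidableEq ι]

/-- A self-adjoint system of matrix units spanning a `*`-algebra. -/
structure IsMatrixUnits (e : ι → ι → A) : Prop where
  mul : ∀ i j k l, e i j * e k l = if j = k then e i l else 0
  star_eq : ∀ i j, star (e i j) = e j i
  sum : ∑ i, e i i = 1
  span : ∀ x, ∃ c : ι → ι → ℂ, x = ∑ i, ∑ j, c i j • e i j
  ne_zero : ∀ i, e i i ≠ 0

theorem IsMatrixUnits.of_starAlgEquiv (π : A ≃⋆ₐ[ℂ] Matrix ι ι ℂ) :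
    IsMatrixUnits fun i j => π.symm (single i j 1) where
  mul i j k l := by
    rw [← map_mul]
    split_ifs with h
    · subst h; simp
    · rw [single_mul_single_of_ne _ _ _ _ h, map_zero]
  star_eq i j := by
    rw [← map_star]
    congr 1
    simp [star_eq_conjTranspose]
  sum := by
    rw [← map_sum, ← map_one π.symm]
    congr 1
    ext i j
    simp [Matrix.sum_apply, single_apply, one_apply, ite_and]
  span x := by
    refine ⟨fun i j => π x i j, ?_⟩
    conv_lhs => rw [← π.symm_apply_apply x, Matrix.matrix_eq_sum_single (π x)]
    simp only [map_sum, ← map_smul, smul_single, smul_eq_mul, mul_one]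
  ne_zero i h := by
    have := congrArg π h
    rw [StarAlgEquiv.apply_symm_apply, map_zero] at this
    have := congrFun (congrFun this i) i
    simp at this

theorem IsMatrixUnits.mul_sum_mul {e : ι → ι → A} (h : IsMatrixUnits e) (c : ι → ι → ℂ) (k l : ι) :
    e k k * (∑ i, ∑ j, c i j • e i j) * e l l = c k l • e k l := by
  simp [Finset.mul_sum, Finset.sum_mul, h.mul]

/-- The star isomorphism with the full matrix algebra given by matrix units. -/
theorem IsMatrixUnits.exists_starAlgEquiv [StarModule ℂ A] {e : ι → ι → A} (h : IsMatrixUnits e) :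
    ∃ π : A ≃⋆ₐ[ℂ] Matrix ι ι ℂ, ∀ i j, π.symm (single i j 1) = e i j := by
  let L : Matrix ι ι ℂ →ₗ[ℂ] A :=
    { toFun := fun g => ∑ i, ∑ j, g i j • e i j
      map_add' := fun x y => by simp [add_smul, Finset.sum_add_distrib]
      map_smul' := fun c x => by simp [Finset.smul_sum, mul_smul] }
  have hL : ∀ g, L g = ∑ i, ∑ j, g i j • e i j := fun _ => rfl
  have hmul : ∀ x y, L (x * y) = L x * L y := by
    intro x y
    have h1 : L x * L y = ∑ i, ∑ k, ∑ j, (x i k * y k j) • e i j := by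
      simp only [hL]
      rw [Finset.sum_mul_sum]
      refine Finset.sum_congr rfl fun i _ => Finset.sum_congr rfl fun k _ => ?_
      rw [Finset.sum_mul_sum, Finset.sum_comm]
      refine Finset.sum_congr rfl fun j _ => ?_
      simp [h.mul, smul_smul, mul_comm]
    rw [h1, hL]
    refine Finset.sum_congr rfl fun i _ => ?_
    rw [Finset.sum_comm]
    simp only [Matrix.mul_apply, Finset.sum_smul]
  have hone : L 1 = 1 := by
    rw [hL, ← h.sum]
    simp [one_apply]
  have hstar : ∀ x, L (star x) = star (L x) := by
    intro x
    simp only [hL, star_sum, star_smul, h.star_eq, star_apply]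
    exact Finset.sum_comm
  let F : Matrix ι ι ℂ →⋆ₐ[ℂ] A :=
    { AlgHom.ofLinearMap L hone hmul with map_star' := hstar }
  have hF : ∀ g, F g = L g := fun _ => rfl
  have hne : ∀ i j, e i j ≠ 0 := fun i j hij => h.ne_zero i <| by
    have := h.mul i j j i
    rw [hij, zero_mul, if_pos rfl] at this
    exact this.symm
  have hbij : Function.Bijective F := by
    constructor
    · rw [injective_iff_map_eq_zero]
      intro g hg
      ext k l
      have := h.mul_sum_mul g k l
      rw [← hL, ← hF, hg, mul_zero, zero_mul] at this
      exact (smul_eq_zero.1 this.symm).resolve_right (hne k l)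
    · intro x
      obtain ⟨c, hc⟩ := h.span x
      exact ⟨Matrix.of c, hc.symm⟩
  refine ⟨(StarAlgEquiv.ofBijective F hbij).symm, fun i j => ?_⟩
  rw [StarAlgEquiv.symm_symm, StarAlgEquiv.ofBijective_apply, hF, hL]
  simp [single_apply, ite_and]

/-- **Skolem–Noether** for matrix algebras, with two index types. -/
theorem exists_conj_of_algEquiv {κ : Type*} [Fintype κ] [DecidableEq κ]
    (f : Matrix κ κ ℂ ≃ₐ[ℂ] Matrix ι ι ℂ) :
    Fintype.card κ = Fintype.card ι ∧ ∃ (P : Matrix ι κ ℂ) (Q : Matrix κ ι ℂ), P * Q = 1 ∧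
      Q * P = 1 ∧ ∀ x, f x = P * x * Q := by
  obtain ⟨T, hT⟩ := AlgEquiv.eq_linearEquivConjAlgEquiv
    ((toLinAlgEquiv'.symm.trans f).trans (toLinAlgEquiv' (R := ℂ) (n := ι)))
  refine ⟨?_, LinearMap.toMatrix' T.toLinearMap, LinearMap.toMatrix' T.symm.toLinearMap, ?_, ?_, ?_⟩
  · have := T.finrank_eq
    simpa using this
  · rw [← LinearMap.toMatrix'_comp]
    simp
  · rw [← LinearMap.toMatrix'_comp]
    simp
  · intro x
    have h := DFunLike.congr_fun hT (toLinAlgEquiv' x)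
    have h2 : toLinAlgEquiv' (f x) = T.toLinearMap ∘ₗ toLinAlgEquiv' x ∘ₗ T.symm.toLinearMap := by
      simpa [LinearEquiv.conjAlgEquiv_apply] using h
    have h3 := congrArg LinearMap.toMatrix' h2
    rw [LinearMap.toMatrix'_comp, LinearMap.toMatrix'_comp] at h3
    rw [Matrix.mul_assoc]
    have h4 : ∀ {σ : Type _} [Fintype σ] [DecidableEq σ] (y : Matrix σ σ ℂ),
        LinearMap.toMatrix' (toLinAlgEquiv' y) = y := fun y => LinearMap.toMatrix'_toLin' y
    have h5 : LinearMap.toMatrix' (toLinAlgEquiv' (f x)) = f x := LinearMap.toMatrix'_toLin' _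
    rwa [h5, h4] at h3

theorem spectralEntropy_eq_of_conj {κ : Type*} [Fintype κ] [DecidableEq κ]
    (hcard : Fintype.card κ = Fintype.card ι) (P : Matrix ι κ ℂ) (Q : Matrix κ ι ℂ) (hPQ : P * Q = 1)
    (ρ : Matrix ι ι ℂ) : spectralEntropy (Q * ρ * P) = spectralEntropy ρ := by
  have h := Matrix.charpoly_mul_comm_of_le (Q * ρ) P hcard.ge
  rw [hcard, Nat.sub_self, pow_zero, one_mul, ← Matrix.mul_assoc, hPQ, Matrix.one_mul] at h
  rw [spectralEntropy, h, spectralEntropy]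

theorem ext_of_trace_mul {κ : Type*} [Fintype κ] [DecidableEq κ] {ρ σ : Matrix κ κ ℂ}
    (h : ∀ x, (ρ * x).trace = (σ * x).trace) : ρ = σ := by
  ext i j
  have := h (single j i 1)
  simpa [Matrix.trace_mul_single] using this

/-- The entropy of a functional, computed in any system of matrix units. -/
theorem IsMatrixUnits.entropy_eq [StarModule ℂ A] {e : ι → ι → A} (h : IsMatrixUnits e)
    (φ : A →ₗ[ℂ] ℂ) : entropy φ = spectralEntropy (Matrix.of fun i j => φ (e j i)) := by
  classical
  obtain ⟨π, hπ⟩ := h.exists_starAlgEquiv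
  have hex : ∃ n : ℕ, Nonempty (A ≃⋆ₐ[ℂ] Matrix (Fin n) (Fin n) ℂ) := by
    obtain ⟨π', -⟩ := (IsMatrixUnits.of_starAlgEquiv π)|>.exists_starAlgEquiv
    let s := Fintype.equivFin ι
    refine ⟨Fintype.card ι, ⟨π.trans
      { Matrix.reindexAlgEquiv ℂ ℂ s with
        map_smul' := fun c x => rfl
        map_star' := fun x => by ext i j; simp }⟩⟩
  -- The isomorphism inside `entropy` is an arbitrary choice, so every isomorphism has to be
  -- treated. Two of them differ by a conjugation, which preserves the characteristic polynomial of
  -- the density matrix.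
  suffices key : ∀ (n : ℕ) (τ : A ≃⋆ₐ[ℂ] Matrix (Fin n) (Fin n) ℂ),
      spectralEntropy (densityMatrix τ φ) = spectralEntropy (Matrix.of fun i j => φ (e j i)) by
    rw [entropy, dif_pos hex]
    exact key _ _
  intro n τ
  obtain ⟨hc, P, Q, hPQ, hQP, hf⟩ := exists_conj_of_algEquiv
    ((τ.symm.trans π).toAlgEquiv)
  have hρ : densityMatrix τ φ = Q * (Matrix.of fun i j => φ (e j i)) * P := by
    refine ext_of_trace_mul fun x => ?_
    have h1 := trace_densityMatrix_mul τ φ (τ.symm x)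
    rw [StarAlgEquiv.apply_symm_apply] at h1
    have h2 : ∀ y : Matrix ι ι ℂ,
        ((Matrix.of fun i j => φ (e j i)) * y).trace = φ (π.symm y) := by
      intro y
      have h1 : π.symm y = ∑ i, ∑ j, y i j • e i j := by
        conv_lhs => rw [Matrix.matrix_eq_sum_single y]
        rw [map_sum]
        refine Finset.sum_congr rfl fun i _ => ?_
        rw [map_sum]
        refine Finset.sum_congr rfl fun j _ => ?_
        rw [← hπ, ← map_smul, Matrix.smul_single, smul_eq_mul, mul_one]
      rw [h1]
      simp only [map_sum, map_smul, Matrix.trace, Matrix.diag_apply, Matrix.mul_apply,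
        Matrix.of_apply, smul_eq_mul]
      rw [Finset.sum_comm]
      simp only [mul_comm]
    have h3 := h2 (P * x * Q)
    rw [← hf] at h3
    have h4 : π.symm ((τ.symm.trans π).toAlgEquiv x) = τ.symm x := by
      simp
    rw [h4, ← h1, hf] at h3
    rw [← h3, Matrix.mul_assoc Q, Matrix.mul_assoc Q, Matrix.trace_mul_comm Q]
    simp only [Matrix.mul_assoc]
  rw [hρ, spectralEntropy_eq_of_conj hc P Q hPQ]

end MatrixUnits

/-! ### Vectors of a tensor product as coefficient matrices. -/

section Coefficients

variable {X Y : Type*} [NormedAddCommGroup X] [InnerProductSpace ℂ X]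
  [NormedAddCommGroup Y] [InnerProductSpace ℂ Y]
  [FiniteDimensional ℂ X] [FiniteDimensional ℂ Y]
  {ι κ : Type*} [Fintype ι] [Fintype κ]
  (b : OrthonormalBasis ι ℂ X) (c : OrthonormalBasis κ ℂ Y)

/-- The matrix of coefficients of a vector of `X ⊗ Y` in orthonormal bases. -/
def coeffs : X ⊗[ℂ] Y →ₗ[ℂ] Matrix ι κ ℂ where
  toFun v := Matrix.of fun i k => inner ℂ (b i ⊗ₜ[ℂ] c k) v
  map_add' v w := by ext; simp [inner_add_right]
  map_smul' a v := by ext; simp [inner_smul_right]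

omit [FiniteDimensional ℂ X] [FiniteDimensional ℂ Y] in
theorem coeffs_apply (v : X ⊗[ℂ] Y) (i : ι) (k : κ) :
    coeffs b c v i k = inner ℂ (b i ⊗ₜ[ℂ] c k) v := rfl

omit [FiniteDimensional ℂ X] [FiniteDimensional ℂ Y] in
theorem coeffs_tmul (x : X) (y : Y) (i : ι) (k : κ) :
    coeffs b c (x ⊗ₜ y) i k = inner ℂ (b i) x * inner ℂ (c k) y := by
  rw [coeffs_apply, TensorProduct.inner_tmul]

omit [FiniteDimensional ℂ X] [FiniteDimensional ℂ Y] in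
theorem sum_coeffs (v : X ⊗[ℂ] Y) :
    v = ∑ i, ∑ k, coeffs b c v i k • (b i ⊗ₜ[ℂ] c k) := by
  classical
  have := (b.tensorProduct c).sum_repr' v
  rw [Fintype.sum_prod_type] at this
  simpa [coeffs_apply] using this.symm

omit [FiniteDimensional ℂ X] [FiniteDimensional ℂ Y] in
theorem hsSq_coeffs (v : X ⊗[ℂ] Y) : hsSq (coeffs b c v) = ‖v‖ ^ 2 := by
  classical
  have := (b.tensorProduct c).sum_sq_norm_inner_right v
  rw [Fintype.sum_prod_type] at this
  simpa [coeffs_apply, hsSq] using this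

theorem coeffs_map [DecidableEq ι] [DecidableEq κ] (S : X →ₗ[ℂ] X) (T : Y →ₗ[ℂ] Y) (v : X ⊗[ℂ] Y) :
    coeffs b c (TensorProduct.map S T v) =
      LinearMap.toMatrixOrthonormal b S * coeffs b c v *
        (LinearMap.toMatrixOrthonormal c T)ᵀ := by
  conv_lhs => rw [sum_coeffs b c v]
  ext i k
  simp only [map_sum, map_smul, TensorProduct.map_tmul, Matrix.sum_apply, Matrix.smul_apply,
    coeffs_tmul, Matrix.mul_apply, transpose_apply, LinearMap.toMatrixOrthonormal_apply_apply,
    smul_eq_mul, Finset.sum_mul]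
  rw [Finset.sum_comm]
  refine Finset.sum_congr rfl fun l _ => Finset.sum_congr rfl fun j _ => ?_
  ring

theorem conjTranspose_toMatrixOrthonormal_mul [CompleteSpace X]
    [DecidableEq ι] (U : unitary (X →L[ℂ] X)) :
    (LinearMap.toMatrixOrthonormal b U.1.toLinearMap)ᴴ *
      LinearMap.toMatrixOrthonormal b U.1.toLinearMap = 1 := by
  rw [← star_eq_conjTranspose, ← map_star, ← map_mul]
  have h : star U.1.toLinearMap * U.1.toLinearMap = (star U.1 * U.1).toLinearMap := by
    rfl
  rw [h, Unitary.coe_star_mul_self]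
  exact map_one (LinearMap.toMatrixOrthonormal b)

-- The matrix unit with entry (j, i) is the operator |b j⟩⟨b i|, whose expectation in v is the (i,
-- j) entry of A Aᴴ, for A the coefficient matrix.
omit [FiniteDimensional ℂ Y] in
theorem leftEntropy_eq_bipartiteEntropy [DecidableEq ι] (v : X ⊗[ℂ] Y) :
    leftEntropy v = bipartiteEntropy (coeffs b c v) := by
  rw [leftEntropy,
    (IsMatrixUnits.of_starAlgEquiv (LinearMap.toMatrixOrthonormal b)).entropy_eq, bipartiteEntropy]
  congr 1
  ext i j
  have hE : ∀ x, (LinearMap.toMatrixOrthonormal b).symm (single j i 1) x = inner ℂ (b i) x • b j := by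
    let R : X →ₗ[ℂ] X := (innerSL ℂ (b i)).toLinearMap.smulRight (b j)
    have hR : LinearMap.toMatrixOrthonormal b R = single j i 1 := by
      ext k l
      rw [LinearMap.toMatrixOrthonormal_apply_apply]
      have : R (b l) = inner ℂ (b i) (b l) • b j := rfl
      rw [this, inner_smul_right, orthonormal_iff_ite.1 b.orthonormal,
        orthonormal_iff_ite.1 b.orthonormal, single_apply]
      simp only [eq_comm, ite_and, mul_ite, mul_one, mul_zero]
    intro x
    rw [← hR, StarAlgEquiv.symm_apply_apply]
    rfl
  rw [Matrix.of_apply]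
  change inner ℂ v (LinearMap.rTensor Y _ v) = _
  have hv : LinearMap.rTensor Y ((LinearMap.toMatrixOrthonormal b).symm (single j i 1)) v =
      ∑ k, coeffs b c v i k • (b j ⊗ₜ[ℂ] c k) := by
    conv_lhs => rw [sum_coeffs b c v]
    simp only [map_sum, map_smul, LinearMap.rTensor_tmul, hE]
    rw [Finset.sum_comm]
    refine Finset.sum_congr rfl fun k _ => ?_
    rw [Finset.sum_eq_single i]
    · simp
    · intro l _ hl
      simp [orthonormal_iff_ite.1 b.orthonormal, Ne.symm hl]
    · simp
  rw [hv, inner_sum, Matrix.mul_apply]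
  refine Finset.sum_congr rfl fun k _ => ?_
  have h1 : inner ℂ v (coeffs b c v i k • (b j ⊗ₜ[ℂ] c k)) =
      coeffs b c v i k * inner ℂ v (b j ⊗ₜ[ℂ] c k) :=
    inner_smul_right (𝕜 := ℂ) (E := X ⊗[ℂ] Y) v (b j ⊗ₜ[ℂ] c k) (coeffs b c v i k)
  rw [h1]
  rw [conjTranspose_apply, RCLike.star_def, coeffs_apply b c v j]
  exact congrArg _ (inner_conj_symm (𝕜 := ℂ) (E := X ⊗[ℂ] Y) v (b j ⊗ₜ[ℂ] c k)).symm

end Coefficients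

/-! ### The decoupling identity in matrix form. -/

section MatrixModel

/-- The shift and clock matrices give an orthogonal basis of unitaries of a matrix algebra. -/
theorem exists_unitary_orthogonal_basis (d : ℕ) [NeZero d] :
    ∃ U : Fin d × Fin d → Matrix (Fin d) (Fin d) ℂ, (∀ α, (U α)ᴴ * U α = 1) ∧
      ∀ x y : Fin d × Fin d, ∑ α, star (U α x.1 x.2) * U α y.1 y.2 = if x = y then (d : ℂ) else 0 := by
  classical
  have e : Fin d ≃ ZMod d := (ZMod.finEquiv d).toEquiv
  let χ : ZMod d → ℂ := fun a => ZMod.stdAddChar a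
  have hχ : ∀ a, star (χ a) * χ a = 1 := by
    intro a
    have h : ‖χ a‖ = 1 := AddChar.norm_apply _ _
    rw [RCLike.star_def, RCLike.conj_mul, h]
    simp
  have hχadd : ∀ a b, star (χ a) * χ b = χ (b - a) := by
    intro a b
    have h : χ b = χ a * χ (b - a) := by
      simp only [χ]
      rw [← AddChar.map_add_eq_mul, add_sub_cancel]
    rw [h, ← mul_assoc, hχ, one_mul]
  -- Multiplication by the character of frequency `α.2`, followed by the cyclic shift by `α.1`.
  let U : Fin d × Fin d → Matrix (Fin d) (Fin d) ℂ := fun α => Matrix.of fun i k =>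
    if e i = e k + e α.1 then χ (e α.2 * e k) else 0
  have hU : ∀ α i k, U α i k = if e i = e k + e α.1 then χ (e α.2 * e k) else 0 := fun _ _ _ => rfl
  refine ⟨U, fun α => ?_, fun x y => ?_⟩
  · ext k l
    rw [Matrix.mul_apply, one_apply]
    simp only [conjTranspose_apply, hU]
    rw [Finset.sum_eq_single (e.symm (e k + e α.1))]
    · rw [if_pos (by simp)]
      by_cases h : k = l
      · subst h
        rw [if_pos rfl, if_pos (by simp), hχ]
      · rw [if_neg h, if_neg, mul_zero]
        simpa using h
    · intro i _ hi
      rw [if_neg, star_zero, zero_mul]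
      intro h
      exact hi (by rw [← h]; simp)
    · simp
  · simp only [hU, Fintype.sum_prod_type]
    -- The entry x is nonzero for exactly one shift. The remaining sum over frequencies is a
    -- character sum, which vanishes unless the column indices of x and y agree.
    rw [Finset.sum_eq_single (e.symm (e x.1 - e x.2))]
    · simp only [Equiv.apply_symm_apply, add_sub_cancel, if_true]
      by_cases h1 : e y.1 = e y.2 + (e x.1 - e x.2)
      · simp only [h1, if_true, hχadd, ← mul_sub]
        rw [e.sum_comp fun a => χ (a * (e y.2 - e x.2))]
        have := AddChar.sum_mulShift (e y.2 - e x.2) (ZMod.isPrimitive_stdAddChar d)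
        simp only [χ]
        rw [this, ZMod.card]
        by_cases h2 : x = y
        · subst h2; simp
        · rw [if_neg h2, if_neg, Nat.cast_zero]
          intro h3
          have h4 : e y.2 = e x.2 := sub_eq_zero.1 h3
          rw [h4, add_sub_cancel] at h1
          exact h2 (Prod.ext (e.injective h1.symm) (e.injective h4.symm))
      · simp only [h1, if_false, mul_zero, Finset.sum_const_zero]
        rw [if_neg]
        rintro rfl
        exact h1 (by simp)
    · intro a _ ha
      refine Finset.sum_eq_zero fun c _ => ?_
      rw [if_neg, star_zero, zero_mul]
      intro h
      exact ha (by rw [h]; simp)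
    · simp

variable {ι κ : Type*} [Fintype ι] [Fintype κ] [DecidableEq ι] [DecidableEq κ] {d : ℕ}

/-- The image of the vector with coefficients `g` under the map with `e i ⊗ e j ↦ W i j`. -/
def combine (W : Fin d → Fin d → Matrix ι κ ℂ) (g : Matrix (Fin d) (Fin d) ℂ) : Matrix ι κ ℂ :=
  ∑ i, ∑ j, g i j • W i j

/-- The Choi vector of the map with `e i ⊗ e j ↦ W i j`. -/
def choiMatrix (W : Fin d → Fin d → Matrix ι κ ℂ) : Matrix (ι × Fin d) (κ × Fin d) ℂ :=
  Matrix.of fun x y => (d : ℂ)⁻¹ * W x.2 y.2 x.1 y.1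

omit [Fintype ι] [Fintype κ] [DecidableEq ι] [DecidableEq κ] in
theorem combine_apply (W : Fin d → Fin d → Matrix ι κ ℂ) (g : Matrix (Fin d) (Fin d) ℂ) (a : ι)
    (b : κ) : combine W g a b = ∑ i, ∑ j, g i j * W i j a b := by
  simp [combine, Matrix.sum_apply]

omit [DecidableEq ι] [DecidableEq κ] in
theorem hsSq_choiMatrix_le [NeZero d] (W : Fin d → Fin d → Matrix ι κ ℂ)
    (hW : ∀ i j, hsSq (W i j) ≤ 1) : hsSq (choiMatrix W) ≤ 1 := by
  have hd : (0 : ℝ) < d := by exact_mod_cast NeZero.pos d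
  have h : hsSq (choiMatrix W) = ((d : ℝ)⁻¹) ^ 2 * ∑ i, ∑ j, hsSq (W i j) := by
    simp only [hsSq, choiMatrix, Matrix.of_apply, Fintype.sum_prod_type, norm_mul, mul_pow,
      norm_inv, Complex.norm_natCast, ← Finset.mul_sum]
    congr 1
    rw [Finset.sum_comm]
    refine Finset.sum_congr rfl fun i _ => ?_
    conv_rhs => rw [Finset.sum_comm]
    refine Finset.sum_congr rfl fun a _ => ?_
    rw [Finset.sum_comm]
  rw [h]
  have h2 : ∑ i, ∑ j, hsSq (W i j) ≤ (d : ℝ) ^ 2 := by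
    refine (Finset.sum_le_sum fun i _ => Finset.sum_le_sum fun j _ => hW i j).trans ?_
    simp [sq]
  calc _ ≤ ((d : ℝ)⁻¹) ^ 2 * (d : ℝ) ^ 2 := by gcongr
    _ = 1 := by rw [← mul_pow, inv_mul_cancel₀ hd.ne', one_pow]

omit [DecidableEq ι] [DecidableEq κ] in
theorem hsSq_submatrix_equiv {ι' κ' : Type*} [Fintype ι'] [Fintype κ'] (e : ι' ≃ ι) (f : κ' ≃ κ)
    (A : Matrix ι κ ℂ) : hsSq (A.submatrix e f) = hsSq A := by
  simp only [hsSq, submatrix_apply]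
  rw [e.sum_comp fun i => ∑ j, ‖A i (f j)‖ ^ 2]
  exact Finset.sum_congr rfl fun i _ => f.sum_comp fun j => ‖A i j‖ ^ 2

section Isometries

variable {μ : Type*} [Fintype μ] [DecidableEq μ]

theorem one_kronecker_isometry (Q : Matrix μ μ ℂ) (hQ : Qᴴ * Q = 1) :
    ((1 : Matrix ι ι ℂ) ⊗ₖ Q)ᴴ * ((1 : Matrix ι ι ℂ) ⊗ₖ Q) = 1 := by
  rw [conjTranspose_kronecker, ← mul_kronecker_mul, hQ, conjTranspose_one, Matrix.one_mul,
    one_kronecker_one]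

theorem blockDiagonal_isometry (S : μ → Matrix ι ι ℂ) (hS : ∀ α, (S α)ᴴ * S α = 1) :
    (blockDiagonal S)ᴴ * blockDiagonal S = 1 := by
  rw [blockDiagonal_conjTranspose, ← blockDiagonal_mul]
  simp only [hS]
  exact blockDiagonal_one

theorem transpose_mul_conjTranspose_transpose (Q : Matrix μ μ ℂ) (hQ : Qᴴ * Q = 1) :
    Qᵀ * (Qᵀ)ᴴ = 1 := by
  have h : Qᵀᴴ = Qᴴᵀ := rfl
  rw [h, ← transpose_mul, hQ, transpose_one]

omit [DecidableEq μ] in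
theorem one_kronecker_mul_apply {σ : Type*} (Q : Matrix μ μ ℂ) (Z : Matrix (ι × μ) σ ℂ) (a : ι)
    (α : μ) (y : σ) : (((1 : Matrix ι ι ℂ) ⊗ₖ Q) * Z) (a, α) y = ∑ x, Q α x * Z (a, x) y := by
  simp [Matrix.mul_apply, Fintype.sum_prod_type, one_apply, ite_mul]

omit [DecidableEq μ] in
theorem mul_one_kronecker_transpose_apply {σ : Type*} (Q : Matrix μ μ ℂ) (Z : Matrix σ (ι × μ) ℂ)
    (x : σ) (a : ι) (α : μ) :
    (Z * ((1 : Matrix ι ι ℂ) ⊗ₖ Q)ᵀ) x (a, α) = ∑ y, Z x (a, y) * Q α y := by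
  simp [Matrix.mul_apply, Fintype.sum_prod_type, one_apply, ite_mul]

omit [DecidableEq ι] in
theorem blockDiagonal_mul_apply {σ : Type*} (S : μ → Matrix ι ι ℂ) (Z : Matrix (ι × μ) σ ℂ) (a : ι)
    (α : μ) (y : σ) : (blockDiagonal S * Z) (a, α) y = ∑ x, S α a x * Z (x, α) y := by
  simp [Matrix.mul_apply, Fintype.sum_prod_type, blockDiagonal_apply, ite_mul]

omit [DecidableEq ι] in
theorem mul_blockDiagonal_transpose_apply {σ : Type*} (S : μ → Matrix ι ι ℂ)
    (Z : Matrix σ (ι × μ) ℂ) (x : σ) (a : ι) (α : μ) :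
    (Z * (blockDiagonal S)ᵀ) x (a, α) = ∑ y, Z x (y, α) * S α a y := by
  simp [Matrix.mul_apply, Fintype.sum_prod_type, blockDiagonal_apply]

end Isometries

/-- If all unitary rotations of `ψ` can be implemented after the map by product unitaries, up to an
error `δ`, then the entropies of the Choi vector, of `ψ` and of its image are additive up to
`δ`. -/
theorem entropy_choiMatrix_add [NeZero d] (W : Fin d → Fin d → Matrix ι κ ℂ)
    (ψ : Matrix (Fin d) (Fin d) ℂ) (hW : ∀ i j, hsSq (W i j) ≤ 1) (hψ : hsSq ψ = 1)
    (hWψ : hsSq (combine W ψ) ≤ 1) {δ : ℝ} (hδ : 0 ≤ δ)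
    (S : Matrix (Fin d) (Fin d) ℂ → Matrix ι ι ℂ) (T : Matrix (Fin d) (Fin d) ℂ → Matrix κ κ ℂ)
    (hS : ∀ U, Uᴴ * U = 1 → (S U)ᴴ * S U = 1) (hT : ∀ U, Uᴴ * U = 1 → (T U)ᴴ * T U = 1)
    (hrec : ∀ U U', Uᴴ * U = 1 → U'ᴴ * U' = 1 →
      hsSq (combine W (U * ψ * U'ᵀ) - S U * combine W ψ * (T U')ᵀ) ≤ δ ^ 2) :
    |bipartiteEntropy ψ + bipartiteEntropy (choiMatrix W) - bipartiteEntropy (combine W ψ)| ≤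
      entropyModulus (Fintype.card ι * (d * d)) δ +
        (1 - hsSq (combine W ψ) + 2 * δ) * Real.log d := by
  obtain ⟨U, hU, hUorth⟩ := exists_unitary_orthogonal_basis d
  have hd : (0 : ℝ) < d := by exact_mod_cast NeZero.pos d
  have hdC : (d : ℂ) ≠ 0 := by exact_mod_cast hd.ne'
  -- The normalization d^(-1/2) makes the matrix Q of all entries of all U α unitary.
  let r : ℂ := ((√(d : ℝ) : ℝ) : ℂ)⁻¹
  have hr : r * r = (d : ℂ)⁻¹ := by
    simp only [r]
    rw [← mul_inv, ← Complex.ofReal_mul, Real.mul_self_sqrt hd.le]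
    simp
  have hrs : star r = r := by simp [r]
  let Q : Matrix (Fin d × Fin d) (Fin d × Fin d) ℂ := Matrix.of fun α x => r * U α x.1 x.2
  have hQ : Qᴴ * Q = 1 := by
    ext x y
    rw [Matrix.mul_apply, one_apply]
    have : ∀ α, Qᴴ x α * Q α y = (d : ℂ)⁻¹ * (star (U α x.1 x.2) * U α y.1 y.2) := by
      intro α
      simp only [Q, conjTranspose_apply, Matrix.of_apply, star_mul', hrs, ← hr]
      ring
    simp only [this, ← Finset.mul_sum, hUorth]
    split_ifs <;> simp [hdC]
  let A := combine W ψ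
  -- The Choi vector times ψ, regrouped so that on each side the reference leg and the leg of ψ form
  -- one index pair, on which Q can act.
  let Z₁ : Matrix (ι × (Fin d × Fin d)) (κ × (Fin d × Fin d)) ℂ :=
    (choiMatrix W ⊗ₖ ψ).submatrix (Equiv.prodAssoc ι (Fin d) (Fin d)).symm
      (Equiv.prodAssoc κ (Fin d) (Fin d)).symm
  let Z₂ := ((1 : Matrix ι ι ℂ) ⊗ₖ Q) * Z₁ * ((1 : Matrix κ κ ℂ) ⊗ₖ Q)ᵀ
  -- The uniform superposition of all pairs of labels (α, β). It is a product vector of norm 1,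
  -- hence adds no entropy.
  let J : Matrix (Fin d × Fin d) (Fin d × Fin d) ℂ :=
    vecMulVec (fun _ => (d : ℂ)⁻¹) (fun _ => (d : ℂ)⁻¹)
  -- Block diagonal matrices are the unitaries controlled by the labels α on the left and β on the
  -- right.
  let Z₃ := blockDiagonal (fun α => S (U α)) * (A ⊗ₖ J) * (blockDiagonal (fun α => T (U α)))ᵀ
  have hSU : (blockDiagonal fun α => S (U α))ᴴ * (blockDiagonal fun α => S (U α)) = 1 :=
    blockDiagonal_isometry _ fun α => hS _ (hU α)
  have hTU : (blockDiagonal fun α => T (U α))ᵀ * ((blockDiagonal fun α => T (U α))ᵀ)ᴴ = 1 :=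
    transpose_mul_conjTranspose_transpose _ (blockDiagonal_isometry _ fun α => hT _ (hU α))
  have hQι : ((1 : Matrix ι ι ℂ) ⊗ₖ Q)ᴴ * ((1 : Matrix ι ι ℂ) ⊗ₖ Q) = 1 :=
    one_kronecker_isometry Q hQ
  have hQκ : ((1 : Matrix κ κ ℂ) ⊗ₖ Q)ᵀ * (((1 : Matrix κ κ ℂ) ⊗ₖ Q)ᵀ)ᴴ = 1 :=
    transpose_mul_conjTranspose_transpose _ (one_kronecker_isometry Q hQ)
  have hunit : ∑ _x : Fin d × Fin d, ‖(d : ℂ)⁻¹‖ ^ 2 = 1 := by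
    simp only [norm_inv, Complex.norm_natCast, Finset.sum_const, Finset.card_univ,
      Fintype.card_prod, Fintype.card_fin, nsmul_eq_mul, Nat.cast_mul]
    field_simp
  have hJ : bipartiteEntropy J = 0 := bipartiteEntropy_vecMulVec _ _ hunit hunit
  have hJ1 : hsSq J = 1 := by
    simp only [hsSq, J, vecMulVec_apply, norm_mul, mul_pow, ← Finset.mul_sum, hunit, mul_one]
  have hE2 : bipartiteEntropy Z₂ = bipartiteEntropy (choiMatrix W) +
      hsSq (choiMatrix W) * bipartiteEntropy ψ := by
    rw [bipartiteEntropy_unitary_mul_mul _ _ _ hQι hQκ, bipartiteEntropy_submatrix_equiv,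
      bipartiteEntropy_kronecker, hψ, one_mul]
  have hE3 : bipartiteEntropy Z₃ = bipartiteEntropy A := by
    rw [bipartiteEntropy_unitary_mul_mul _ _ _ hSU hTU, bipartiteEntropy_kronecker, hJ, hJ1]
    ring
  have hN2 : hsSq Z₂ = hsSq (choiMatrix W) := by
    rw [hsSq_mul_unitary _ _ hQκ, hsSq_unitary_mul _ _ hQι, hsSq_submatrix_equiv, hsSq_kronecker,
      hψ, mul_one]
  have hN3 : hsSq Z₃ = hsSq A := by
    rw [hsSq_mul_unitary _ _ hTU, hsSq_unitary_mul _ _ hSU, hsSq_kronecker, hJ1, mul_one]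
  -- Contracting Q with the reference leg and with ψ performs the rotation: each block of Z₂ is the
  -- code applied to (U α ⊗ U β)ψ. The factor d⁻² collects d⁻¹ from the Choi vector and d^(-1/2)
  -- from each Q.
  have hZ2 : ∀ a α b β, Z₂ (a, α) (b, β) =
      ((d : ℂ)⁻¹ * (d : ℂ)⁻¹) * combine W (U α * ψ * (U β)ᵀ) a b := by
    intro a α b β
    simp only [Z₂]
    rw [mul_one_kronecker_transpose_apply]
    simp only [one_kronecker_mul_apply]
    simp only [combine_apply, Matrix.mul_apply, transpose_apply, Z₁,
      submatrix_apply, Equiv.prodAssoc_symm_apply, kronecker_apply, choiMatrix, Matrix.of_apply, Q,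
      Fintype.sum_prod_type, Finset.sum_mul, Finset.mul_sum]
    conv_rhs => rw [Finset.sum_comm]
    refine Finset.sum_congr rfl fun j _ => ?_
    conv_rhs => rw [Finset.sum_comm]
    refine Finset.sum_congr rfl fun l _ => Finset.sum_congr rfl fun i _ =>
      Finset.sum_congr rfl fun k _ => ?_
    rw [← hr]
    ring
  have hZ3 : ∀ a α b β, Z₃ (a, α) (b, β) =
      ((d : ℂ)⁻¹ * (d : ℂ)⁻¹) * (S (U α) * A * (T (U β))ᵀ) a b := by
    intro a α b β
    simp only [Z₃]
    rw [mul_blockDiagonal_transpose_apply]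
    simp only [blockDiagonal_mul_apply]
    simp only [Matrix.mul_apply, transpose_apply, kronecker_apply, J,
      vecMulVec_apply, Finset.sum_mul, Finset.mul_sum]
    refine Finset.sum_congr rfl fun x _ => Finset.sum_congr rfl fun y _ => ?_
    ring
  -- The d⁴ blocks carry weight d⁻⁴ each, so the total error is an average of the reconstruction
  -- errors.
  have hdiff : hsSq (Z₂ - Z₃) ≤ δ ^ 2 := by
    have h1 : hsSq (Z₂ - Z₃) = ∑ α, ∑ β, (‖(d : ℂ)⁻¹‖ ^ 2 * ‖(d : ℂ)⁻¹‖ ^ 2) *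
        hsSq (combine W (U α * ψ * (U β)ᵀ) - S (U α) * A * (T (U β))ᵀ) := by
      simp only [hsSq]
      rw [Fintype.sum_prod_type, Finset.sum_comm]
      refine Finset.sum_congr rfl fun α _ => ?_
      simp only [Fintype.sum_prod_type_right (α₁ := κ)]
      rw [Finset.sum_comm]
      refine Finset.sum_congr rfl fun β _ => ?_
      simp only [Finset.mul_sum]
      refine Finset.sum_congr rfl fun a _ => Finset.sum_congr rfl fun b _ => ?_
      rw [Matrix.sub_apply, hZ2, hZ3, ← mul_sub, norm_mul, norm_mul, mul_pow, mul_pow,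
        Matrix.sub_apply]
    rw [h1]
    calc _ ≤ ∑ α : Fin d × Fin d, ∑ β : Fin d × Fin d,
          (‖(d : ℂ)⁻¹‖ ^ 2 * ‖(d : ℂ)⁻¹‖ ^ 2) * δ ^ 2 :=
          Finset.sum_le_sum fun α _ => Finset.sum_le_sum fun β _ =>
            mul_le_mul_of_nonneg_left (hrec _ _ (hU α) (hU β)) (by positivity)
      _ = δ ^ 2 := by
        simp only [← Finset.sum_mul, hunit, one_mul]
  have hC1 := hsSq_choiMatrix_le W hW
  have hmain := abs_bipartiteEntropy_sub_le Z₂ Z₃ (hN2.trans_le hC1) (hN3.trans_le hWψ) hδ hdiff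
  have hnorm := sum_abs_row_sub_le Z₂ Z₃ (hN2.trans_le hC1) (hN3.trans_le hWψ) hδ hdiff
  have hnorm' : |hsSq Z₂ - hsSq Z₃| ≤ 2 * δ := by
    refine le_trans ?_ hnorm
    simp only [hsSq]
    rw [← Finset.sum_sub_distrib]
    exact Finset.abs_sum_le_sum_abs _ _
  rw [hN2, hN3] at hnorm'
  rw [hE2, hE3] at hmain
  simp only [Fintype.card_prod, Fintype.card_fin] at hmain
  have hψ0 := bipartiteEntropy_nonneg ψ hψ.le
  have hψ1 := bipartiteEntropy_le_log ψ hψ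
  rw [Fintype.card_fin] at hψ1
  have hlog : 0 ≤ Real.log d := Real.log_natCast_nonneg _
  -- Replacing the weight ‖Choi‖² of S(ψ) by 1 costs (1 - ‖Choi‖²) S(ψ). Closeness of the norms and
  -- S(ψ) ≤ log d bound this.
  have h3 : (1 - hsSq (choiMatrix W)) * bipartiteEntropy ψ ≤
      (1 - hsSq A + 2 * δ) * Real.log d := by
    have := (abs_le.1 hnorm').1
    exact mul_le_mul (by linarith) hψ1 hψ0 (by linarith)
  have h4 : 0 ≤ (1 - hsSq (choiMatrix W)) * bipartiteEntropy ψ :=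
    mul_nonneg (by linarith) hψ0
  rw [abs_le] at hmain ⊢
  constructor <;> linarith [hmain.1, hmain.2]

end MatrixModel

/-! ### The entropy formula for a bipartitioned regulated space. -/

section Bipartition

variable {H : Type*} [NormedAddCommGroup H] [InnerProductSpace ℂ H] [CompleteSpace H]
  {N : VonNeumannAlgebra H} {Ω : H}

theorem mem_regSpace {x : H →L[ℂ] H} (hx : x ∈ N) (Ω : H) : x Ω ∈ regSpace N Ω :=
  Submodule.le_topologicalClosure _ (Submodule.subset_span ⟨x, hx, rfl⟩)

theorem self_mem_regSpace (N : VonNeumannAlgebra H) (Ω : H) : Ω ∈ regSpace N Ω :=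
  mem_regSpace (x := 1) N.one_mem' Ω

theorem coe_leftAction (x : N.toStarSubalgebra) (v : regSpace N Ω) :
    (leftAction N Ω x v : H) = (x : H →L[ℂ] H) v := rfl

theorem leftAction_mul (x y : N.toStarSubalgebra) (v : regSpace N Ω) :
    leftAction N Ω (x * y) v = leftAction N Ω x (leftAction N Ω y v) := rfl

theorem inner_leftAction_star (x : N.toStarSubalgebra) (v w : regSpace N Ω) :
    inner ℂ v (leftAction N Ω (star x) w) = inner ℂ (leftAction N Ω x v) w := by
  rw [Submodule.coe_inner, Submodule.coe_inner, coe_leftAction, coe_leftAction]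
  exact ContinuousLinearMap.adjoint_inner_right _ _ _

theorem leftAction_injective (hsep : ∀ x ∈ N, x Ω = 0 → x = 0) {x y : N.toStarSubalgebra}
    (h : ∀ v, leftAction N Ω x v = leftAction N Ω y v) : x = y := by
  have h1 := congrArg Subtype.val (h ⟨Ω, self_mem_regSpace N Ω⟩)
  rw [coe_leftAction, coe_leftAction] at h1
  have h2 := hsep ((x - y : N.toStarSubalgebra) : H →L[ℂ] H) (x - y).2 (by
    change ((x : H →L[ℂ] H) - (y : H →L[ℂ] H)) Ω = 0
    rw [_root_.sub_apply, sub_eq_zero]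
    exact h1)
  exact sub_eq_zero.1 (Subtype.ext h2)

theorem star_leftAction (x : N.toStarSubalgebra) :
    star (leftAction N Ω x) = leftAction N Ω (star x) := by
  symm
  refine (ContinuousLinearMap.eq_adjoint_iff _ _).2 fun v w => ?_
  rw [← inner_leftAction_star, star_star]

theorem exists_rightUnitary_of_commute (R : regSpace N Ω ≃ₗᵢ[ℂ] regSpace N Ω)
    (hcomm : ∀ x v, R (leftAction N Ω x v) = leftAction N Ω x (R v)) :
    ∃ UR : RightUnitary N Ω, ∀ v, UR.1.1 v = R v := by
  let u := Unitary.linearIsometryEquiv.symm R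
  have hmem : u.1 ∈ rightAlgebra N Ω := by
    rw [rightAlgebra, StarSubalgebra.mem_centralizer_iff]
    rintro _ ⟨x, rfl⟩
    refine ⟨?_, ?_⟩
    · ext1 v
      exact (hcomm x v).symm
    · rw [star_leftAction]
      ext1 v
      exact (hcomm (star x) v).symm
  refine ⟨⟨⟨u.1, hmem⟩, ?_⟩, fun v => rfl⟩
  rw [Unitary.mem_iff]
  have := u.2
  rw [Unitary.mem_iff] at this
  exact ⟨Subtype.ext this.1, Subtype.ext this.2⟩

variable (B : Bipartition N Ω)

theorem Bipartition.norm_coe_Φ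
    (v : EuclideanSpace ℂ (Fin B.d) ⊗[ℂ] EuclideanSpace ℂ (Fin B.d)) : ‖(B.Φ v : H)‖ = ‖v‖ :=
  B.Φ.norm_map v

/-- As Ω is separating, an element of N is determined by its action on the regulated space. The
element representing T ⊗ 1 is therefore unique, and the algebraic relations of the T pass to N. -/
theorem Bipartition.exists_starAlgEquiv (hsep : ∀ x ∈ N, x Ω = 0 → x = 0) :
    ∃ F : (EuclideanSpace ℂ (Fin B.d) →ₗ[ℂ] EuclideanSpace ℂ (Fin B.d)) ≃⋆ₐ[ℂ] N.toStarSubalgebra,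
      ∀ T v, leftAction N Ω (F T) (B.Φ v) = B.Φ (LinearMap.rTensor _ T v) := by
  choose f hf using B.mem_of_left
  have hext : ∀ {x y : N.toStarSubalgebra},
      (∀ v, leftAction N Ω x (B.Φ v) = leftAction N Ω y (B.Φ v)) → x = y := by
    intro x y h
    refine leftAction_injective hsep fun v => ?_
    rw [← B.Φ.apply_symm_apply v]
    exact h _
  have hadd : ∀ S T, f (S + T) = f S + f T := fun S T => hext fun v => by
    rw [hf, LinearMap.rTensor_add, LinearMap.add_apply, map_add, ← hf, ← hf]
    rfl
  have hsmul : ∀ (c : ℂ) T, f (c • T) = c • f T := fun c T => hext fun v => by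
    rw [hf, LinearMap.rTensor_smul, LinearMap.smul_apply, map_smul, ← hf]
    rfl
  have hmul : ∀ S T, f (S * T) = f S * f T := fun S T => hext fun v => by
    rw [hf, leftAction_mul, hf, hf, LinearMap.rTensor_mul]
    rfl
  have hstar : ∀ T, f (star T) = star (f T) := fun T => hext fun v => by
    refine ext_inner_left ℂ fun w => ?_
    obtain ⟨w, rfl⟩ := B.Φ.surjective w
    rw [inner_leftAction_star, hf, hf, B.Φ.inner_map_map, B.Φ.inner_map_map]
    have h1 : LinearMap.rTensor (EuclideanSpace ℂ (Fin B.d)) (star T) =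
        (LinearMap.rTensor (EuclideanSpace ℂ (Fin B.d)) T).adjoint := by
      rw [LinearMap.rTensor, LinearMap.rTensor, TensorProduct.adjoint_map]
      congr 1
      simp
    rw [h1, LinearMap.adjoint_inner_right]
  have hinj : Function.Injective f := by
    intro S T h
    have h1 : ∀ v, LinearMap.rTensor (EuclideanSpace ℂ (Fin B.d)) S v =
        LinearMap.rTensor (EuclideanSpace ℂ (Fin B.d)) T v := fun v =>
      B.Φ.injective (by rw [← hf, ← hf, h])
    refine LinearMap.ext fun x => ?_
    by_cases hx : x = 0
    · rw [hx, map_zero, map_zero]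
    · have h2 := h1 (x ⊗ₜ x)
      rw [LinearMap.rTensor_tmul, LinearMap.rTensor_tmul, ← sub_eq_zero, ← TensorProduct.sub_tmul,
        ← norm_eq_zero, TensorProduct.norm_tmul, mul_eq_zero, norm_eq_zero, norm_eq_zero] at h2
      exact sub_eq_zero.1 (h2.resolve_right hx)
  have hsurj : Function.Surjective f := by
    intro x
    obtain ⟨T, hT⟩ := B.left_of_mem x
    exact ⟨T, hext fun v => by rw [hf, hT]⟩
  exact ⟨{ Equiv.ofBijective f ⟨hinj, hsurj⟩ with
    map_mul' := hmul
    map_add' := hadd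
    map_star' := hstar
    map_smul' := hsmul }, hf⟩

theorem Bipartition.vectorEntropy_eq (hsep : ∀ x ∈ N, x Ω = 0 → x = 0)
    (v : EuclideanSpace ℂ (Fin B.d) ⊗[ℂ] EuclideanSpace ℂ (Fin B.d)) :
    vectorEntropy N.toStarSubalgebra (B.Φ v : H) = leftEntropy v := by
  obtain ⟨F, hF⟩ := B.exists_starAlgEquiv hsep
  let π := LinearMap.toMatrixOrthonormal (EuclideanSpace.basisFun (Fin B.d) ℂ)
  rw [vectorEntropy, leftEntropy, (IsMatrixUnits.of_starAlgEquiv π).entropy_eq,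
    (IsMatrixUnits.of_starAlgEquiv (F.symm.trans π)).entropy_eq]
  congr 1
  ext i j
  have h := hF (π.symm (single j i 1)) v
  have h2 := congrArg (fun w => inner ℂ (B.Φ v) w) h
  simp only [B.Φ.inner_map_map] at h2
  exact h2

theorem Bipartition.exists_leftUnitary (hsep : ∀ x ∈ N, x Ω = 0 → x = 0)
    (U : Matrix (Fin B.d) (Fin B.d) ℂ) (hU : Uᴴ * U = 1) :
    ∃ UL : LeftUnitary N, ∀ v, leftAction N Ω UL.1 (B.Φ v) = B.Φ (LinearMap.rTensor _
      ((LinearMap.toMatrixOrthonormal (EuclideanSpace.basisFun (Fin B.d) ℂ)).symm U) v) := by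
  obtain ⟨F, hF⟩ := B.exists_starAlgEquiv hsep
  let π := LinearMap.toMatrixOrthonormal (EuclideanSpace.basisFun (Fin B.d) ℂ)
  refine ⟨⟨F (π.symm U), ?_⟩, fun v => hF _ v⟩
  rw [Unitary.mem_iff]
  constructor
  · rw [← map_star, ← map_mul, ← map_star, ← map_mul, star_eq_conjTranspose, hU, map_one, map_one]
  · rw [← map_star, ← map_mul, ← map_star, ← map_mul, star_eq_conjTranspose,
      mul_eq_one_comm.1 hU, map_one, map_one]

theorem Bipartition.exists_rightUnitary
    (U : Matrix (Fin B.d) (Fin B.d) ℂ) (hU : Uᴴ * U = 1) :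
    ∃ UR : RightUnitary N Ω, ∀ v, UR.1.1 (B.Φ v) = B.Φ (LinearMap.lTensor _
      ((LinearMap.toMatrixOrthonormal (EuclideanSpace.basisFun (Fin B.d) ℂ)).symm U) v) := by
  let b := EuclideanSpace.basisFun (Fin B.d) ℂ
  let π := LinearMap.toMatrixOrthonormal b
  have h1 : π.symm Uᴴ * π.symm U = 1 := by rw [← map_mul, hU, map_one]
  have h2 : π.symm U * π.symm Uᴴ = 1 := by rw [← map_mul, mul_eq_one_comm.1 hU, map_one]
  let t : EuclideanSpace ℂ (Fin B.d) ≃ₗ[ℂ] EuclideanSpace ℂ (Fin B.d) :=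
    LinearEquiv.ofLinearMap (π.symm U) (π.symm Uᴴ) h2 h1
  let T : EuclideanSpace ℂ (Fin B.d) ≃ₗᵢ[ℂ] EuclideanSpace ℂ (Fin B.d) :=
    t.isometryOfInner fun x y => by
      change inner ℂ (π.symm U x) (π.symm U y) = inner ℂ x y
      rw [← LinearMap.adjoint_inner_right, ← LinearMap.star_eq_adjoint, ← map_star,
        star_eq_conjTranspose]
      exact congrArg _ (LinearMap.congr_fun h1 y)
  let R : regSpace N Ω ≃ₗᵢ[ℂ] regSpace N Ω := (B.Φ.symm.trans (T.lTensor _)).trans B.Φ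
  have hR : ∀ v, R (B.Φ v) = B.Φ (LinearMap.lTensor _ (π.symm U) v) := by
    intro v
    simp [R]
    rfl
  have hcomm : ∀ x v, R (leftAction N Ω x v) = leftAction N Ω x (R v) := by
    intro x v
    obtain ⟨v, rfl⟩ := B.Φ.surjective v
    obtain ⟨S, hS⟩ := B.left_of_mem x
    rw [hS, hR, hR, hS, ← LinearMap.comp_apply, ← LinearMap.comp_apply,
      LinearMap.lTensor_comp_rTensor, LinearMap.rTensor_comp_lTensor]
  obtain ⟨UR, hUR⟩ := exists_rightUnitary_of_commute R hcomm
  exact ⟨UR, fun v => (hUR _).trans (hR v)⟩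

variable {X Y : Type*} [NormedAddCommGroup X] [InnerProductSpace ℂ X] [FiniteDimensional ℂ X]
  [NormedAddCommGroup Y] [InnerProductSpace ℂ Y] [FiniteDimensional ℂ Y]

/-- Reconstruction of the orbit of `ψ` from the image of `ψ` itself. -/
def ReconstructsOrbit [CompleteSpace X] [CompleteSpace Y] (N : VonNeumannAlgebra H) (Ω : H)
    (V : H →L[ℂ] X ⊗[ℂ] Y) (ψ : regSpace N Ω) (δ : ℝ) : Prop :=
  ∃ (tildeUL : LeftUnitary N → unitary (X →L[ℂ] X))
    (tildeUR : RightUnitary N Ω → unitary (Y →L[ℂ] Y)),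
    ∀ (UL : LeftUnitary N) (UR : RightUnitary N Ω),
      ‖V (act UL UR ψ) -
        TensorProduct.map (tildeUL UL).1.toLinearMap (tildeUR UR).1.toLinearMap (V ψ)‖ ≤ δ

section Codes

variable {ι κ : Type*} [Fintype ι] [Fintype κ] (bX : OrthonormalBasis ι ℂ X)
  (bY : OrthonormalBasis κ ℂ Y) (V : H →L[ℂ] X ⊗[ℂ] Y)

/-- The coefficient matrices of the images of the product basis vectors under the code. -/
def Bipartition.codeCoeffs (i j : Fin B.d) : Matrix ι κ ℂ :=
  coeffs bX bY (V (B.Φ (EuclideanSpace.basisFun (Fin B.d) ℂ i ⊗ₜ[ℂ]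
    EuclideanSpace.basisFun (Fin B.d) ℂ j)))

omit [FiniteDimensional ℂ X] [FiniteDimensional ℂ Y] in
theorem Bipartition.combine_codeCoeffs
    (v : EuclideanSpace ℂ (Fin B.d) ⊗[ℂ] EuclideanSpace ℂ (Fin B.d)) :
    combine (B.codeCoeffs bX bY V) (coeffs (EuclideanSpace.basisFun (Fin B.d) ℂ)
      (EuclideanSpace.basisFun (Fin B.d) ℂ) v) = coeffs bX bY (V (B.Φ v)) := by
  let L : EuclideanSpace ℂ (Fin B.d) ⊗[ℂ] EuclideanSpace ℂ (Fin B.d) →ₗ[ℂ] Matrix ι κ ℂ :=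
    coeffs bX bY ∘ₗ V.toLinearMap ∘ₗ (regSpace N Ω).subtype ∘ₗ B.Φ.toLinearEquiv.toLinearMap
  have hL : ∀ w, coeffs bX bY (V (B.Φ w)) = L w := fun _ => rfl
  conv_rhs => rw [sum_coeffs (EuclideanSpace.basisFun (Fin B.d) ℂ)
      (EuclideanSpace.basisFun (Fin B.d) ℂ) v]
  rw [hL]
  simp only [map_sum, map_smul]
  rfl

omit [FiniteDimensional ℂ X] [FiniteDimensional ℂ Y] in
theorem Bipartition.hsSq_codeCoeffs_le (hV : ‖V‖ ≤ 1) (i j : Fin B.d) :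
    hsSq (B.codeCoeffs bX bY V i j) ≤ 1 := by
  rw [codeCoeffs, hsSq_coeffs]
  refine pow_le_one₀ (norm_nonneg _) ?_
  refine (V.le_of_opNorm_le hV _).trans ?_
  rw [one_mul, B.norm_coe_Φ, TensorProduct.norm_tmul]
  simp

-- The rearrangement pairs the left reference leg with X and the right one with Y. In product bases
-- the maximally entangled vector then selects one code coefficient for each pair of reference
-- indices.
omit [FiniteDimensional ℂ Y] in
theorem Bipartition.choiEntropy_eq [DecidableEq ι] [DecidableEq κ] :
    choiEntropy B V = bipartiteEntropy (choiMatrix (B.codeCoeffs bX bY V)) := by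
  let b := EuclideanSpace.basisFun (Fin B.d) ℂ
  rw [choiEntropy, leftEntropy_eq_bipartiteEntropy (bX.tensorProduct b) (bY.tensorProduct b)]
  congr 1
  have hb : ∀ i, EuclideanSpace.single i (1 : ℂ) = b i := fun i =>
    (EuclideanSpace.basisFun_apply (Fin B.d) ℂ i).symm
  have key : ∀ (w : X ⊗[ℂ] Y) (i j : Fin B.d) (x : ι × Fin B.d) (y : κ × Fin B.d),
      coeffs (bX.tensorProduct b) (bY.tensorProduct b)
        (TensorProduct.tensorTensorTensorComm ℂ X Y _ _ (w ⊗ₜ[ℂ] (EuclideanSpace.single i (1 : ℂ) ⊗ₜ[ℂ]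
          EuclideanSpace.single j (1 : ℂ)))) x y =
      coeffs bX bY w x.1 y.1 * ((if x.2 = i then 1 else 0) * if y.2 = j then 1 else 0) := by
    intro w i j x y
    induction w with
    | zero => simp
    | tmul p q =>
      rw [TensorProduct.tensorTensorTensorComm_tmul, coeffs_tmul, coeffs_tmul,
        OrthonormalBasis.tensorProduct_apply', OrthonormalBasis.tensorProduct_apply',
        TensorProduct.inner_tmul, TensorProduct.inner_tmul]
      simp only [hb, orthonormal_iff_ite.1 b.orthonormal]
      ring
    | add p q hp hq =>
      rw [TensorProduct.add_tmul, map_add, map_add, Matrix.add_apply, hp, hq, map_add,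
        Matrix.add_apply, add_mul]
  ext x y
  rw [choiVector, maxEntangled]
  simp only [map_smul, map_sum, LinearMap.rTensor_tmul, Matrix.smul_apply, Matrix.sum_apply, key,
    choiMatrix, Matrix.of_apply]
  rw [smul_eq_mul, Finset.sum_eq_single x.2, Finset.sum_eq_single y.2]
  · rw [if_pos rfl, if_pos rfl, one_mul, mul_one, hb, hb]
    rfl
  · intro j _ hj
    rw [if_neg hj.symm, mul_zero, mul_zero]
  · simp
  · intro i _ hi
    refine Finset.sum_eq_zero fun j _ => ?_
    rw [if_neg hi.symm, zero_mul, mul_zero]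
  · simp

/-- Translation of `entropy_choiMatrix_add`: matrix unitaries U, U' become bulk unitaries through
the bipartition, and their reconstructions supply S and T. -/
theorem Bipartition.abs_entropy_add_sub_le [CompleteSpace X] [CompleteSpace Y]
    (hsep : ∀ x ∈ N, x Ω = 0 → x = 0) (hV : ‖V‖ ≤ 1) (ψ : regSpace N Ω) (hψ : ‖ψ‖ = 1) {δ : ℝ}
    (hrec : ReconstructsOrbit N Ω V ψ δ) :
    |vectorEntropy N.toStarSubalgebra (ψ : H) + choiEntropy B V - leftEntropy (V ψ)| ≤
      entropyModulus (Module.finrank ℂ X * (B.d * B.d)) δ +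
        (1 - ‖V ψ‖ ^ 2 + 2 * δ) * Real.log B.d := by
  let bX := stdOrthonormalBasis ℂ X
  let bY := stdOrthonormalBasis ℂ Y
  let b := EuclideanSpace.basisFun (Fin B.d) ℂ
  obtain ⟨v, rfl⟩ := B.Φ.surjective ψ
  rw [B.Φ.norm_map] at hψ
  obtain ⟨tL, tR, ht⟩ := hrec
  have hδ : 0 ≤ δ := (norm_nonneg _).trans (ht 1 1)
  -- In dimension 0 there is no unit vector ψ.
  have hd : NeZero B.d := by
    refine ⟨fun h => ?_⟩
    have hv := hsSq_coeffs b b v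
    rw [hψ] at hv
    have : IsEmpty (Fin B.d) := by rw [h]; infer_instance
    simp [hsSq] at hv
  choose uL huL using fun U : {U : Matrix (Fin B.d) (Fin B.d) ℂ // Uᴴ * U = 1} =>
    B.exists_leftUnitary hsep U.1 U.2
  choose uR huR using fun U : {U : Matrix (Fin B.d) (Fin B.d) ℂ // Uᴴ * U = 1} =>
    B.exists_rightUnitary U.1 U.2
  have hact : ∀ U U', B.Φ.symm (act (uL U) (uR U') (B.Φ v)) = TensorProduct.map
      ((LinearMap.toMatrixOrthonormal b).symm U.1) ((LinearMap.toMatrixOrthonormal b).symm U'.1) v := by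
    intro U U'
    rw [act, huR, huL, B.Φ.symm_apply_apply, ← LinearMap.comp_apply,
      LinearMap.rTensor_comp_lTensor]
  classical
  let S : Matrix (Fin B.d) (Fin B.d) ℂ → Matrix _ _ ℂ := fun U =>
    if h : Uᴴ * U = 1 then LinearMap.toMatrixOrthonormal bX (tL (uL ⟨U, h⟩)).1.toLinearMap else 1
  let T : Matrix (Fin B.d) (Fin B.d) ℂ → Matrix _ _ ℂ := fun U =>
    if h : Uᴴ * U = 1 then LinearMap.toMatrixOrthonormal bY (tR (uR ⟨U, h⟩)).1.toLinearMap else 1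
  have hS : ∀ U, Uᴴ * U = 1 → (S U)ᴴ * S U = 1 := by
    intro U hU
    simp only [S, dif_pos hU]
    exact conjTranspose_toMatrixOrthonormal_mul bX _
  have hT : ∀ U, Uᴴ * U = 1 → (T U)ᴴ * T U = 1 := by
    intro U hU
    simp only [T, dif_pos hU]
    exact conjTranspose_toMatrixOrthonormal_mul bY _
  have hVv : hsSq (coeffs bX bY (V (B.Φ v))) ≤ 1 := by
    rw [hsSq_coeffs]
    refine pow_le_one₀ (norm_nonneg _) ((V.le_of_opNorm_le hV _).trans ?_)
    rw [one_mul, B.norm_coe_Φ, hψ]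
  have main := entropy_choiMatrix_add (B.codeCoeffs bX bY V) (coeffs b b v)
    (B.hsSq_codeCoeffs_le bX bY V hV) (by rw [hsSq_coeffs, hψ, one_pow])
    (by rwa [B.combine_codeCoeffs]) hδ S T hS hT (by
      intro U U' hU hU'
      have h1 : U * coeffs b b v * U'ᵀ =
          coeffs b b (B.Φ.symm (act (uL ⟨U, hU⟩) (uR ⟨U', hU'⟩) (B.Φ v))) := by
        rw [hact, coeffs_map, StarAlgEquiv.apply_symm_apply, StarAlgEquiv.apply_symm_apply]
      rw [h1, B.combine_codeCoeffs, B.combine_codeCoeffs, LinearIsometryEquiv.apply_symm_apply]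
      simp only [S, T, dif_pos hU, dif_pos hU']
      rw [← coeffs_map, ← map_sub, hsSq_coeffs]
      exact pow_le_pow_left₀ (norm_nonneg _) (ht _ _) 2)
  rw [B.combine_codeCoeffs, ← B.choiEntropy_eq, hsSq_coeffs, ← leftEntropy_eq_bipartiteEntropy,
    ← leftEntropy_eq_bipartiteEntropy, Fintype.card_fin, ← B.vectorEntropy_eq hsep] at main
  exact main

end Codes

end Bipartition

/-! ### Matrix units from minimal projections, and relative commutants. -/

section Frames

variable {H : Type*} [NormedAddCommGroup H] [InnerProductSpace ℂ H] [CompleteSpace H]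

/-- `p` is a minimal projection of `A`. -/
structure IsMinimalProjection (A : StarSubalgebra ℂ (H →L[ℂ] H)) (p : H →L[ℂ] H) : Prop where
  mem : p ∈ A
  isStarProjection : IsStarProjection p
  ne_zero : p ≠ 0
  corner : ∀ x ∈ A, ∃ c : ℂ, p * x * p = c • p

/-- The first column `u i = e i 0` of a system of matrix units of `A`, with `p = e 0 0` a minimal
projection. -/
structure IsFrame {ι : Type*} [Fintype ι] [DecidableEq ι] (A : StarSubalgebra ℂ (H →L[ℂ] H))
    (p : H →L[ℂ] H) (u : ι → H →L[ℂ] H) : Prop where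
  minimal : IsMinimalProjection A p
  mem : ∀ i, u i ∈ A
  mul_proj : ∀ i, u i * p = u i
  orthonormal : ∀ i j, star (u i) * u j = if i = j then p else 0
  sum : ∑ i, u i * star (u i) = 1

variable {A : StarSubalgebra ℂ (H →L[ℂ] H)} {p : H →L[ℂ] H}

theorem eq_zero_of_star_mul_self_eq_zero {y : H →L[ℂ] H} (h : star y * y = 0) : y = 0 :=
  CStarRing.star_mul_self_eq_zero_iff y |>.1 h

/-- For a unit vector ξ fixed by p, minimality gives p x p = ⟨ξ, x ξ⟩ p. Thus r x p ↦ r x ξ carries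
the p-valued inner product of r A p to that of H, and an orthonormal basis of r A ξ lifts to the
desired elements. -/
theorem IsMinimalProjection.exists_orthonormal (hp : IsMinimalProjection A p)
    [FiniteDimensional ℂ A] {r : H →L[ℂ] H} (hr : r ∈ A) (hr' : IsStarProjection r) :
    ∃ (n : ℕ) (t : Fin n → H →L[ℂ] H), (∀ i, t i ∈ A) ∧ (∀ i, t i * p = t i) ∧
      (∀ i, r * t i = t i) ∧ (∀ i j, star (t i) * t j = if i = j then p else 0) ∧
      ∀ x ∈ A, (∑ i, t i * star (t i)) * (r * x * p) = r * x * p := by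
  have hpp : p * p = p := hp.isStarProjection.isIdempotentElem
  have hps : star p = p := hp.isStarProjection.isSelfAdjoint
  have hrr : r * r = r := hr'.isIdempotentElem
  have hrs : star r = r := hr'.isSelfAdjoint
  obtain ⟨ξ, hξ, hpξ⟩ : ∃ ξ : H, ‖ξ‖ = 1 ∧ p ξ = ξ := by
    obtain ⟨η, hη⟩ : ∃ η, p η ≠ 0 := by
      by_contra! h
      exact hp.ne_zero (ContinuousLinearMap.ext h)
    refine ⟨((‖p η‖ : ℂ)⁻¹) • p η, norm_smul_inv_norm hη, ?_⟩
    rw [map_smul, ← mul_apply_eq_comp, hpp]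
  have hcorner : ∀ x ∈ A, p * x * p = (inner ℂ ξ (x ξ) : ℂ) • p := by
    intro x hx
    obtain ⟨c, hc⟩ := hp.corner x hx
    have h1 : inner ℂ ξ ((p * x * p) ξ) = inner ℂ ξ (x ξ) := by
      rw [mul_apply_eq_comp, mul_apply_eq_comp, hpξ]
      calc inner ℂ ξ (p (x ξ)) = inner ℂ ((star p) ξ) (x ξ) := by
            rw [ContinuousLinearMap.star_eq_adjoint, ContinuousLinearMap.adjoint_inner_left]
        _ = _ := by rw [hps, hpξ]
    rw [hc, _root_.smul_apply, hpξ, inner_smul_right, inner_self_eq_norm_sq_to_K, hξ]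
      at h1
    rw [hc, ← h1]
    simp
  let L : A →ₗ[ℂ] H :=
    { toFun := fun x => r ((x : H →L[ℂ] H) ξ)
      map_add' := fun x y => by simp
      map_smul' := fun c x => by simp }
  have hL : ∀ x : A, L x = r ((x : H →L[ℂ] H) ξ) := fun _ => rfl
  let w := stdOrthonormalBasis ℂ L.range
  choose x hx using fun i => (w i).2
  have hsq : ∀ x ∈ A, ∀ y ∈ A, star (r * x * p) * (r * y * p) =
      (inner ℂ (r (x ξ)) (r (y ξ)) : ℂ) • p := by
    intro x hx y hy
    have h1 : star (r * x * p) * (r * y * p) = p * (star x * r * y) * p := by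
      rw [star_mul, star_mul, hps, hrs]
      calc p * (star x * r) * (r * y * p) = p * (star x * (r * r) * y) * p := by
            simp only [mul_assoc]
        _ = _ := by rw [hrr]
    rw [h1, hcorner _ (mul_mem (mul_mem (star_mem hx) hr) hy)]
    congr 1
    have h2 : star x * r * y = star x * (star r * (r * y)) := by
      rw [hrs, ← mul_assoc r, hrr, mul_assoc]
    rw [h2, mul_apply_eq_comp, ContinuousLinearMap.star_eq_adjoint,
      ContinuousLinearMap.adjoint_inner_right, mul_apply_eq_comp,
      ContinuousLinearMap.star_eq_adjoint, ContinuousLinearMap.adjoint_inner_right]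
    rfl
  have hw : ∀ i j, (inner ℂ (r ((x i : H →L[ℂ] H) ξ)) (r ((x j : H →L[ℂ] H) ξ)) : ℂ) =
      if i = j then 1 else 0 := by
    intro i j
    rw [← hL, ← hL, hx, hx, ← Submodule.coe_inner]
    exact orthonormal_iff_ite.1 w.orthonormal i j
  refine ⟨_, fun i => r * x i * p, fun i => mul_mem (mul_mem hr (x i).2) hp.mem,
    fun i => by rw [mul_assoc, hpp], fun i => by rw [← mul_assoc, ← mul_assoc, hrr], ?_, ?_⟩
  · intro i j
    rw [hsq _ (x i).2 _ (x j).2, hw]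
    split_ifs <;> simp
  · intro y hy
    let c : Fin _ → ℂ := fun i => w.repr ⟨L ⟨y, hy⟩, LinearMap.mem_range_self _ _⟩ i
    -- The element minus its expansion in the basis. It satisfies r z ξ = 0, and the inner product
    -- formula then forces r z p = 0.
    let z : A := ⟨y, hy⟩ - ∑ i, c i • x i
    have hz : r ((z : H →L[ℂ] H) ξ) = 0 := by
      rw [← hL]
      simp only [z, map_sub, map_sum, map_smul, hx]
      rw [sub_eq_zero]
      have := congrArg Subtype.val (w.sum_repr ⟨L ⟨y, hy⟩, LinearMap.mem_range_self _ _⟩)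
      refine this.symm.trans ?_
      simp [c]
    have hz0 : r * (z : H →L[ℂ] H) * p = 0 := by
      refine eq_zero_of_star_mul_self_eq_zero ?_
      rw [hsq _ z.2 _ z.2, hz, inner_zero_left, zero_smul]
    have hy' : r * y * p = ∑ i, c i • (r * (x i : H →L[ℂ] H) * p) := by
      have h1 : (z : H →L[ℂ] H) = y - ∑ i, c i • (x i : H →L[ℂ] H) := by
        simp [z]
      rw [h1, mul_sub, sub_mul, sub_eq_zero] at hz0
      rw [hz0, Finset.mul_sum, Finset.sum_mul]
      simp
    rw [hy', Finset.mul_sum]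
    refine Finset.sum_congr rfl fun j _ => ?_
    rw [mul_smul_comm, Finset.sum_mul]
    congr 1
    rw [Finset.sum_eq_single j]
    · rw [mul_assoc, hsq _ (x j).2 _ (x j).2, hw, if_pos rfl, one_smul, mul_assoc, hpp]
    · intro i _ hi
      rw [mul_assoc, hsq _ (x i).2 _ (x j).2, hw, if_neg hi, zero_smul, mul_zero]
    · simp

/-- Take an orthonormal system spanning A p. Since A p is a left ideal, e = ∑ u i (u i)* commutes
with A; so e is a scalar by factoriality, and e p = p makes it 1. -/
theorem IsMinimalProjection.exists_frame (hp : IsMinimalProjection A p) [FiniteDimensional ℂ A]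
    (hA : ∀ x ∈ A, (∀ y ∈ A, y * x = x * y) → ∃ c : ℂ, x = c • (1 : H →L[ℂ] H)) :
    ∃ (n : ℕ) (u : Fin n → H →L[ℂ] H), IsFrame A p u := by
  obtain ⟨n, u, hu, hup, -, huu, hx⟩ := hp.exists_orthonormal (one_mem A) (IsStarProjection.one _)
  refine ⟨n, u, hp, hu, hup, huu, ?_⟩
  set e := ∑ i, u i * star (u i) with he
  have hes : star e = e := by simp [he, star_sum, star_mul]
  have hemem : e ∈ A := sum_mem fun i _ => mul_mem (hu i) (star_mem (hu i))
  have h1 : ∀ y ∈ A, e * (y * e) = y * e := by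
    intro y hy
    rw [he, Finset.mul_sum, Finset.mul_sum, ← he]
    refine Finset.sum_congr rfl fun i _ => ?_
    have h2 := hx (y * u i) (mul_mem hy (hu i))
    rw [one_mul, mul_assoc, hup] at h2
    rw [← mul_assoc y, ← mul_assoc e, h2]
  obtain ⟨c, hc⟩ := hA e hemem fun y hy => by
    rw [← h1 y hy]
    have h2 := congrArg star (h1 (star y) (star_mem hy))
    rw [star_mul, star_mul, star_star, hes] at h2
    rw [← mul_assoc]
    exact h2
  have h2 := hx 1 (one_mem A)
  rw [one_mul, one_mul, hc, smul_mul_assoc, one_mul] at h2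
  have h3 : (c - 1) • p = 0 := by rw [sub_smul, one_smul, h2, sub_self]
  have h4 := (smul_eq_zero.1 h3).resolve_right hp.ne_zero
  rw [hc, sub_eq_zero.1 h4, one_smul]

section

variable {ι : Type*} [Fintype ι] [DecidableEq ι] {u : ι → H →L[ℂ] H}

theorem IsFrame.proj_mul_star (h : IsFrame A p u) (i : ι) : p * star (u i) = star (u i) := by
  have := congrArg star (h.mul_proj i)
  rwa [star_mul, h.minimal.isStarProjection.isSelfAdjoint] at this

theorem IsFrame.ne_zero (h : IsFrame A p u) (i : ι) : u i ≠ 0 := by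
  intro h0
  have := h.orthonormal i i
  rw [h0, mul_zero, if_pos rfl] at this
  exact h.minimal.ne_zero this.symm

/-- The matrix units of a frame. -/
def IsFrame.units (h : IsFrame A p u) (i j : ι) : A :=
  ⟨u i * star (u j), mul_mem (h.mem i) (star_mem (h.mem j))⟩

theorem IsFrame.star_mul_mul (h : IsFrame A p u) {x : H →L[ℂ] H} (hx : x ∈ A) (i j : ι) :
    ∃ c : ℂ, star (u i) * x * u j = c • p := by
  obtain ⟨c, hc⟩ := h.minimal.corner (star (u i) * x * u j)
    (mul_mem (mul_mem (star_mem (h.mem i)) hx) (h.mem j))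
  refine ⟨c, ?_⟩
  have h1 : p * (star (u i) * x * u j) * p = (p * star (u i)) * x * (u j * p) := by
    simp only [mul_assoc]
  rw [← hc, h1, h.proj_mul_star, h.mul_proj]

theorem IsFrame.isMatrixUnits (h : IsFrame A p u) : IsMatrixUnits h.units where
  mul i j k l := by
    apply Subtype.ext
    have h1 : ((h.units i j * h.units k l : A) : H →L[ℂ] H) =
        u i * (star (u j) * u k) * star (u l) := by
      simp only [IsFrame.units, MulMemClass.mk_mul_mk, mul_assoc]
    rw [h1, h.orthonormal]
    split_ifs
    · rw [h.mul_proj]; rfl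
    · simp
  star_eq i j := by
    apply Subtype.ext
    change star (u i * star (u j)) = u j * star (u i)
    rw [star_mul, star_star]
  sum := by
    apply Subtype.ext
    rw [AddSubmonoidClass.coe_finsetSum]
    exact h.sum
  span x := by
    choose c hc using fun i j => h.star_mul_mul x.2 i j
    refine ⟨c, Subtype.ext ?_⟩
    rw [AddSubmonoidClass.coe_finsetSum]
    simp only [AddSubmonoidClass.coe_finsetSum]
    have h1 : ∀ i j, ((c i j • h.units i j : A) : H →L[ℂ] H) =
        u i * star (u i) * x * (u j * star (u j)) := by
      intro i j
      have h2 : u i * star (u i) * (x : H →L[ℂ] H) * (u j * star (u j)) =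
          u i * (star (u i) * x * u j) * star (u j) := by simp only [mul_assoc]
      rw [h2, hc, mul_smul_comm, h.mul_proj, smul_mul_assoc]
      rfl
    simp only [h1]
    simp only [← Finset.mul_sum, ← Finset.sum_mul]
    rw [h.sum, one_mul, mul_one]
  ne_zero i h0 := by
    have h1 : u i * star (u i) = 0 := congrArg Subtype.val h0
    have h2 : u i * star (u i) * u i = u i := by
      rw [mul_assoc, h.orthonormal, if_pos rfl, h.mul_proj]
    rw [h1, zero_mul] at h2
    exact h.ne_zero i h2.symm

/-- In a frame, the density matrix of a vector functional. -/
def frameDensity (u : ι → H →L[ℂ] H) (v : H) : Matrix ι ι ℂ :=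
  Matrix.of fun i j => inner ℂ v ((u j * star (u i)) v)

theorem IsFrame.vectorEntropy_eq (h : IsFrame A p u) (v : H) :
    vectorEntropy A v = spectralEntropy (frameDensity u v) :=
  h.isMatrixUnits.entropy_eq _

-- The density matrix is a transposed Gram matrix, hence positive. The factor C is a purification,
-- which makes the results on `bipartiteEntropy` available.
open scoped ComplexOrder MatrixOrder in
theorem IsFrame.exists_mul_conjTranspose (h : IsFrame A p u) (v : H) :
    ∃ C : Matrix ι ι ℂ, frameDensity u v = C * Cᴴ ∧ hsSq C = ‖v‖ ^ 2 := by
  have h1 : frameDensity u v = (Matrix.gram ℂ fun i => star (u i) v)ᵀ := by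
    ext i j
    rw [frameDensity, Matrix.of_apply, transpose_apply, Matrix.gram_apply,
      mul_apply_eq_comp, ContinuousLinearMap.star_eq_adjoint (u j),
      ContinuousLinearMap.adjoint_inner_left]
  have h2 : (frameDensity u v).PosSemidef := by
    rw [h1]
    exact (Matrix.posSemidef_gram ℂ _).transpose
  obtain ⟨y, hy⟩ := CStarAlgebra.nonneg_iff_eq_star_mul_self.mp h2.nonneg
  have h3 : frameDensity u v = yᴴ * yᴴᴴ := by rw [hy, conjTranspose_conjTranspose]; rfl
  refine ⟨yᴴ, h3, ?_⟩
  have h4 := trace_mul_conjTranspose_self yᴴ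
  rw [← h3] at h4
  have h5 : (frameDensity u v).trace = inner ℂ v v := by
    simp only [Matrix.trace, Matrix.diag_apply, frameDensity, Matrix.of_apply]
    rw [← inner_sum, ← _root_.sum_apply, h.sum]
    rfl
  rw [h5, inner_self_eq_norm_sq_to_K] at h4
  refine Complex.ofReal_injective ?_
  rw [← h4]
  push_cast
  rfl

end

/-- Compatible frames for an inclusion `A ≤ A'` of type I factors and the relative commutant. -/
theorem IsFrame.exists_relative {A' : StarSubalgebra ℂ (H →L[ℂ] H)} [FiniteDimensional ℂ A']
    (hle : A ≤ A') {ι : Type*} [Fintype ι] [DecidableEq ι] {u : ι → H →L[ℂ] H} (hu : IsFrame A p u)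
    {q' : H →L[ℂ] H} (hq' : IsMinimalProjection A' q')
    (hA' : ∀ x ∈ A', (∀ y ∈ A', y * x = x * y) → ∃ c : ℂ, x = c • (1 : H →L[ℂ] H))
    (R : StarSubalgebra ℂ (H →L[ℂ] H)) (hR : ∀ x, x ∈ R ↔ x ∈ A' ∧ ∀ y ∈ A, y * x = x * y) :
    ∃ (q : H →L[ℂ] H) (m : ℕ) (t : Fin m → H →L[ℂ] H),
      IsFrame A' q (fun x : ι × Fin m => u x.1 * t x.2) ∧
      IsFrame R (∑ i, u i * q * star (u i)) (fun a => ∑ i, u i * t a * star (u i)) ∧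
      ∀ i j a b, (u j * star (u i)) * ((∑ k, u k * t b * star (u k)) *
        star (∑ k, u k * t a * star (u k))) = (u j * t b) * star (u i * t a) := by
  have hpp : p * p = p := hu.minimal.isStarProjection.isIdempotentElem
  have hps : star p = p := hu.minimal.isStarProjection.isSelfAdjoint
  have hpA : p ∈ A' := hle hu.minimal.mem
  -- a minimal projection of `A'` below `p`
  obtain ⟨q, hq, hpq⟩ : ∃ q, IsMinimalProjection A' q ∧ p * q = q := by
    obtain ⟨n, w, hw⟩ := hq'.exists_frame hA'
    obtain ⟨a, ha⟩ : ∃ a, p * w a ≠ 0 := by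
      by_contra! h0
      apply hu.minimal.ne_zero
      rw [← mul_one p, ← hw.sum, Finset.mul_sum]
      exact Finset.sum_eq_zero fun i _ => by rw [← mul_assoc, h0, zero_mul]
    -- Minimality of q' gives v* v = c q' with c ≠ 0. So v is a multiple of a partial isometry from
    -- q' to c⁻¹ v v*, a minimal projection below p.
    set v := p * w a with hv
    have hvA : v ∈ A' := mul_mem hpA (hw.mem a)
    have hvq : v * q' = v := by rw [hv, mul_assoc, hw.mul_proj]
    have hqv : q' * star v = star v := by
      have := congrArg star hvq
      rwa [star_mul, hq'.isStarProjection.isSelfAdjoint] at this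
    have hcorner : ∀ x ∈ A', ∃ c : ℂ, star v * x * v = c • q' := by
      intro x hx
      obtain ⟨c, hc⟩ := hq'.corner (star v * x * v) (mul_mem (mul_mem (star_mem hvA) hx) hvA)
      refine ⟨c, ?_⟩
      have h1 : q' * (star v * x * v) * q' = (q' * star v) * x * (v * q') := by
        simp only [mul_assoc]
      rw [← hc, h1, hqv, hvq]
    obtain ⟨c, hc⟩ := hcorner 1 (one_mem _)
    rw [mul_one] at hc
    have hc0 : c ≠ 0 := by
      rintro rfl
      rw [zero_smul] at hc
      exact ha (eq_zero_of_star_mul_self_eq_zero hc)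
    have hcs : star c = c := by
      have h1 := congrArg star hc
      rw [star_mul, star_star, hc, star_smul, hq'.isStarProjection.isSelfAdjoint, ← sub_eq_zero,
        ← sub_smul] at h1
      exact (sub_eq_zero.1 ((smul_eq_zero.1 h1).resolve_right hq'.ne_zero)).symm
    have hvv : v * star v * v = c • v := by rw [mul_assoc, hc, mul_smul_comm, hvq]
    refine ⟨c⁻¹ • (v * star v), ⟨?_, ⟨?_, ?_⟩, ?_, ?_⟩, ?_⟩
    · exact A'.smul_mem (mul_mem hvA (star_mem hvA)) _
    · change c⁻¹ • (v * star v) * c⁻¹ • (v * star v) = c⁻¹ • (v * star v)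
      rw [smul_mul_smul_comm, ← mul_assoc (v * star v), hvv, smul_mul_assoc, smul_smul, mul_assoc,
        inv_mul_cancel₀ hc0, mul_one]
    · change star (c⁻¹ • (v * star v)) = _
      rw [star_smul, star_mul, star_star, star_inv₀, hcs]
    · intro h0
      have h1 : (c⁻¹ • (v * star v)) * v = v := by
        rw [smul_mul_assoc, hvv, smul_smul, inv_mul_cancel₀ hc0, one_smul]
      rw [h0, zero_mul] at h1
      exact ha h1.symm
    · intro x hx
      obtain ⟨k, hk⟩ := hcorner x hx
      refine ⟨c⁻¹ * k, ?_⟩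
      have h1 : (c⁻¹ • (v * star v)) * x * (c⁻¹ • (v * star v)) =
          (c⁻¹ * c⁻¹) • (v * (star v * x * v) * star v) := by
        simp only [smul_mul_assoc, mul_smul_comm, smul_smul, mul_assoc]
      rw [h1, hk, mul_smul_comm, hvq, smul_mul_assoc, smul_smul, smul_smul]
      congr 1
      ring
    · rw [mul_smul_comm, ← mul_assoc, hv, ← mul_assoc, hpp]
  have hqq : q * q = q := hq.isStarProjection.isIdempotentElem
  have hqs : star q = q := hq.isStarProjection.isSelfAdjoint
  obtain ⟨m, t, htA, htq, hpt, htt, hsum⟩ := hq.exists_orthonormal hpA hu.minimal.isStarProjection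
  have hst : ∀ a, star (t a) * p = star (t a) := by
    intro a
    have := congrArg star (hpt a)
    rwa [star_mul, hps] at this
  have hqst : ∀ a, q * star (t a) = star (t a) := by
    intro a
    have := congrArg star (htq a)
    rwa [star_mul, hqs] at this
  have hqp : q * p = q := by
    have := congrArg star hpq
    rwa [star_mul, hps, hqs] at this
  have htp : ∀ a, t a * p = t a := by
    intro a
    rw [← htq a, mul_assoc, hqp]
  -- the vectors `t a` resolve `p`
  have hsump : ∑ a, t a * star (t a) = p := by
    obtain ⟨n, w, hw⟩ := hq.exists_frame hA'
    have h1 : (∑ a, t a * star (t a)) * p = p := by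
      rw [← mul_one p, ← hw.sum, Finset.mul_sum, Finset.mul_sum]
      refine Finset.sum_congr rfl fun a _ => ?_
      have h2 := hsum (w a) (hw.mem a)
      rw [mul_assoc p, hw.mul_proj] at h2
      rw [← mul_assoc p, ← mul_assoc, h2]
    rw [← h1, Finset.sum_mul]
    exact Finset.sum_congr rfl fun a _ => by rw [mul_assoc, hst]
  -- amplification to the commutant
  have hamp : ∀ x y : H →L[ℂ] H, p * y = y →
      (∑ k, u k * x * star (u k)) * (∑ k, u k * y * star (u k)) =
        ∑ k, u k * (x * y) * star (u k) := by
    intro x y hy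
    rw [Finset.sum_mul]
    refine Finset.sum_congr rfl fun k _ => ?_
    rw [Finset.mul_sum, Finset.sum_eq_single k]
    · have h1 : u k * x * star (u k) * (u k * y * star (u k)) =
          u k * x * (star (u k) * u k) * y * star (u k) := by simp only [mul_assoc]
      rw [h1, hu.orthonormal, if_pos rfl, mul_assoc _ p, hy]
      simp only [mul_assoc]
    · intro l _ hl
      have h1 : u k * x * star (u k) * (u l * y * star (u l)) =
          u k * x * (star (u k) * u l) * y * star (u l) := by simp only [mul_assoc]
      rw [h1, hu.orthonormal, if_neg hl.symm, mul_zero, zero_mul, zero_mul]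
    · simp
  have hampstar : ∀ x : H →L[ℂ] H,
      star (∑ k, u k * x * star (u k)) = ∑ k, u k * star x * star (u k) := by
    intro x
    simp only [star_sum, star_mul, star_star, mul_assoc]
  have hstar_units : ∀ (x : H →L[ℂ] H) i, p * x = x →
      star (u i) * (∑ k, u k * x * star (u k)) = x * star (u i) := by
    intro x i hx
    rw [Finset.mul_sum, Finset.sum_eq_single i]
    · rw [← mul_assoc, ← mul_assoc, hu.orthonormal, if_pos rfl, hx]
    · intro k _ hk
      rw [← mul_assoc, ← mul_assoc, hu.orthonormal, if_neg hk.symm, zero_mul, zero_mul]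
    · simp
  have hunits_amp : ∀ (x : H →L[ℂ] H) i j, p * x = x →
      (u j * star (u i)) * (∑ k, u k * x * star (u k)) = u j * x * star (u i) := by
    intro x i j hx
    rw [mul_assoc, hstar_units x i hx, mul_assoc]
  have hamp_units : ∀ (x : H →L[ℂ] H) i j, x * p = x →
      (∑ k, u k * x * star (u k)) * (u j * star (u i)) = u j * x * star (u i) := by
    intro x i j hx
    rw [Finset.sum_mul, Finset.sum_eq_single j]
    · rw [← mul_assoc, mul_assoc _ (star (u j)), hu.orthonormal, if_pos rfl, mul_assoc (u j), hx]
    · intro k _ hk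
      rw [← mul_assoc, mul_assoc _ (star (u k)), hu.orthonormal, if_neg hk, mul_zero, zero_mul]
    · simp
  -- Commuting with A need only be checked on the matrix units of the frame.
  have hampR : ∀ x ∈ A', p * x = x → x * p = x → ∑ k, u k * x * star (u k) ∈ R := by
    intro x hx hpx hxp
    rw [hR]
    refine ⟨sum_mem fun k _ => mul_mem (mul_mem (hle (hu.mem k)) hx)
      (star_mem (hle (hu.mem k))), fun y hy => ?_⟩
    obtain ⟨c, hc⟩ := hu.isMatrixUnits.span ⟨y, hy⟩
    have hc' : y = ∑ i, ∑ j, c i j • (u i * star (u j)) := by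
      have := congrArg Subtype.val hc
      rw [AddSubmonoidClass.coe_finsetSum] at this
      simp only [AddSubmonoidClass.coe_finsetSum] at this
      exact this
    rw [hc', Finset.sum_mul, Finset.mul_sum]
    refine Finset.sum_congr rfl fun i _ => ?_
    rw [Finset.sum_mul, Finset.mul_sum]
    refine Finset.sum_congr rfl fun j _ => ?_
    rw [smul_mul_assoc, mul_smul_comm, hunits_amp x j i hpx, hamp_units x j i hxp]
  have hι : Nonempty ι := by
    by_contra hne
    rw [not_isEmpty_iff.symm, not_not] at hne
    have h1 := hu.sum
    rw [Finset.univ_eq_empty, Finset.sum_empty] at h1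
    exact hu.minimal.ne_zero (by rw [← mul_one p, ← h1, mul_zero])
  refine ⟨q, m, t, ⟨hq, fun x => mul_mem (hle (hu.mem _)) (htA _), fun x => ?_, ?_, ?_⟩,
    ⟨⟨hampR q hq.mem hpq hqp, ⟨?_, ?_⟩, ?_, ?_⟩,
      fun a => hampR (t a) (htA a) (hpt a) (htp a), ?_, ?_, ?_⟩, ?_⟩
  · rw [mul_assoc, htq]
  · rintro ⟨i, a⟩ ⟨j, b⟩
    have h1 : star (u i * t a) * (u j * t b) = star (t a) * (star (u i) * u j) * t b := by
      simp only [star_mul, mul_assoc]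
    dsimp only
    rw [h1, hu.orthonormal]
    by_cases hij : i = j
    · rw [if_pos hij, hst, htt]
      simp [hij]
    · rw [if_neg hij, mul_zero, zero_mul, if_neg (by simp [hij])]
  · rw [Fintype.sum_prod_type, ← hu.sum]
    refine Finset.sum_congr rfl fun i _ => ?_
    have h1 : ∀ a, u i * t a * star (u i * t a) = u i * (t a * star (t a)) * star (u i) := by
      intro a; simp only [star_mul, mul_assoc]
    simp only [h1]
    rw [← Finset.sum_mul, ← Finset.mul_sum, hsump, hu.mul_proj]
  · change (∑ k, u k * q * star (u k)) * (∑ k, u k * q * star (u k)) = _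
    rw [hamp q q hpq, hqq]
  · change star (∑ k, u k * q * star (u k)) = _
    rw [hampstar, hqs]
  · intro h0
    obtain ⟨i⟩ := hι
    have h1 := hstar_units q i hpq
    rw [h0, mul_zero] at h1
    have h2 : q * star (u i) * u i = q := by rw [mul_assoc, hu.orthonormal, if_pos rfl, hqp]
    rw [← h1, zero_mul] at h2
    exact hq.ne_zero h2.symm
  · intro x hx
    obtain ⟨hxA, hxc⟩ := (hR x).1 hx
    obtain ⟨i₀⟩ := hι
    -- An element commuting with A is block diagonal for the frame, with all diagonal blocks equal.
    -- Minimality of the amplified q thus reduces to minimality of q in A'.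
    have hcomm : ∀ i j, star (u i) * x * u j = if i = j then star (u i₀) * x * u i₀ else 0 := by
      intro i j
      have h1 : star (u i) * x * u j = star (u i) * (u j * star (u i₀) * x) * u i₀ := by
        rw [hxc _ (mul_mem (hu.mem j) (star_mem (hu.mem i₀)))]
        have h2 : star (u i) * (x * (u j * star (u i₀))) * u i₀ =
            star (u i) * x * (u j * (star (u i₀) * u i₀)) := by simp only [mul_assoc]
        rw [h2, hu.orthonormal, if_pos rfl, hu.mul_proj]
      have h3 : star (u i) * (u j * star (u i₀) * x) * u i₀ =
          (star (u i) * u j) * star (u i₀) * x * u i₀ := by simp only [mul_assoc]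
      rw [h1, h3, hu.orthonormal]
      split_ifs
      · rw [hu.proj_mul_star]
      · rw [zero_mul, zero_mul, zero_mul]
    obtain ⟨c, hc⟩ := hq.corner (star (u i₀) * x * u i₀)
      (mul_mem (mul_mem (star_mem (hle (hu.mem _))) hxA) (hle (hu.mem _)))
    refine ⟨c, ?_⟩
    rw [Finset.sum_mul, Finset.sum_mul, Finset.smul_sum]
    refine Finset.sum_congr rfl fun i _ => ?_
    rw [Finset.mul_sum, Finset.sum_eq_single i]
    · have h1 : u i * q * star (u i) * x * (u i * q * star (u i)) =
          u i * (q * (star (u i) * x * u i) * q) * star (u i) := by simp only [mul_assoc]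
      rw [h1, hcomm, if_pos rfl, hc, mul_smul_comm, smul_mul_assoc]
    · intro j _ hj
      have h1 : u i * q * star (u i) * x * (u j * q * star (u j)) =
          u i * (q * (star (u i) * x * u j) * q) * star (u j) := by simp only [mul_assoc]
      rw [h1, hcomm, if_neg hj.symm, mul_zero, zero_mul, mul_zero, zero_mul]
    · simp
  · intro a
    rw [hamp _ _ hpq, htq]
  · intro a b
    rw [hampstar, hamp _ _ (hpt b), htt]
    split_ifs
    · rfl
    · simp
  · have h1 : ∀ a, (∑ k, u k * t a * star (u k)) * star (∑ k, u k * t a * star (u k)) =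
        ∑ k, u k * (t a * star (t a)) * star (u k) := by
      intro a
      rw [hampstar, hamp]
      rw [← hqst, ← mul_assoc, hpq]
    simp only [h1]
    rw [Finset.sum_comm, ← hu.sum]
    refine Finset.sum_congr rfl fun i _ => ?_
    rw [← Finset.sum_mul, ← Finset.mul_sum, hsump, hu.mul_proj]
  · intro i j a b
    have h1 : p * star (t a) = star (t a) := by rw [← hqst, ← mul_assoc, hpq]
    rw [hampstar, hamp _ _ h1, hunits_amp]
    · simp only [star_mul, mul_assoc]
    · rw [← mul_assoc, hpt]

end Frames

/-! ### The regulated space of a finite-dimensional factor. -/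

section RegSpace

variable {H : Type*} [NormedAddCommGroup H] [InnerProductSpace ℂ H] [CompleteSpace H]
  {N : VonNeumannAlgebra H} {Ω : H}

/-- N Ω is a finite-dimensional subspace, hence already closed. -/
theorem mem_regSpace_iff [FiniteDimensional ℂ N.toStarSubalgebra] {v : H} :
    v ∈ regSpace N Ω ↔ ∃ x : N.toStarSubalgebra, (x : H →L[ℂ] H) Ω = v := by
  let L : N.toStarSubalgebra →ₗ[ℂ] H :=
    { toFun := fun x => (x : H →L[ℂ] H) Ω
      map_add' := fun x y => by simp
      map_smul' := fun c x => by simp }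
  have hspan : Submodule.span ℂ {v : H | ∃ x ∈ N, v = x Ω} = L.range := by
    apply le_antisymm
    · refine Submodule.span_le.2 ?_
      rintro _ ⟨x, hx, rfl⟩
      exact ⟨⟨x, hx⟩, rfl⟩
    · rintro _ ⟨x, rfl⟩
      exact Submodule.subset_span ⟨x, x.2, rfl⟩
  have hcl : regSpace N Ω = L.range := by
    rw [regSpace, hspan]
    exact (Submodule.closed_of_finiteDimensional _).submodule_topologicalClosure_eq
  rw [hcl]
  rfl

instance [FiniteDimensional ℂ N.toStarSubalgebra] : FiniteDimensional ℂ (regSpace N Ω) := by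
  let L : N.toStarSubalgebra →ₗ[ℂ] regSpace N Ω :=
    { toFun := fun x => leftAction N Ω x ⟨Ω, self_mem_regSpace N Ω⟩
      map_add' := fun x y => rfl
      map_smul' := fun c x => rfl }
  refine Module.Finite.of_surjective L fun v => ?_
  obtain ⟨x, hx⟩ := mem_regSpace_iff.1 v.2
  exact ⟨x, Subtype.ext hx⟩

/-- The regulated space is the orthogonal sum of the copies u i K, where K is spanned by the vectors
(u j)* Ω. These n vectors are independent because Ω is separating, so K also has dimension n. The
vectors u i f j, with f an orthonormal basis of K, then form the product basis. -/
theorem IsFrame.nonempty_bipartition [FiniteDimensional ℂ N.toStarSubalgebra] {n : ℕ}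
    {p : H →L[ℂ] H} {u : Fin n → H →L[ℂ] H} (h : IsFrame N.toStarSubalgebra p u)
    (hsep : ∀ x ∈ N, x Ω = 0 → x = 0) : Nonempty (Bipartition N Ω) := by
  have hli : LinearIndependent ℂ fun j => (star (u j)) Ω := by
    rw [Fintype.linearIndependent_iff]
    intro g hg i
    have h1 : ∑ j, g j • star (u j) = 0 := by
      have hm : ∑ j, g j • star (u j) ∈ N.toStarSubalgebra :=
        sum_mem fun j _ => N.toStarSubalgebra.smul_mem (star_mem (h.mem j)) _
      refine hsep _ hm ?_
      rw [← hg]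
      simp
    have h2 := congrArg (fun y => y * u i) h1
    simp only [Finset.sum_mul, smul_mul_assoc, h.orthonormal, zero_mul] at h2
    rw [Finset.sum_eq_single i (fun j _ hj => by rw [if_neg hj, smul_zero]) (by simp),
      if_pos rfl] at h2
    exact (smul_eq_zero.1 h2).resolve_right h.minimal.ne_zero
  set K := Submodule.span ℂ (Set.range fun j => (star (u j)) Ω) with hK
  have hfr : Module.finrank ℂ K = n := by
    rw [hK, finrank_span_eq_card hli, Fintype.card_fin]
  have : FiniteDimensional ℂ K := FiniteDimensional.span_of_finite ℂ (Set.finite_range _)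
  let f : OrthonormalBasis (Fin n) ℂ K := (stdOrthonormalBasis ℂ K).reindex (finCongr hfr)
  have hpf : ∀ w ∈ K, p w = w := by
    intro w hw
    induction hw using Submodule.span_induction with
    | mem w hw =>
      obtain ⟨j, rfl⟩ := hw
      change (p * star (u j)) Ω = _
      rw [h.proj_mul_star]
    | zero => simp
    | add x y _ _ hx hy => rw [map_add, hx, hy]
    | smul c x _ hx => rw [map_smul, hx]
  have hKreg : K ≤ regSpace N Ω := by
    refine Submodule.span_le.2 ?_
    rintro _ ⟨j, rfl⟩
    exact mem_regSpace (star_mem (h.mem j)) Ω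
  let e : Fin n × Fin n → regSpace N Ω := fun x =>
    ⟨u x.1 (f x.2), map_mem_regSpace N Ω ⟨u x.1, h.mem _⟩ (hKreg (f x.2).2)⟩
  have hu : ∀ i j w, (star (u i)) ((u j) w) = if i = j then p w else 0 := by
    intro i j w
    rw [← mul_apply_eq_comp, h.orthonormal]
    split_ifs <;> rfl
  have hon : Orthonormal ℂ e := by
    rw [orthonormal_iff_ite]
    rintro ⟨i, j⟩ ⟨k, l⟩
    rw [Submodule.coe_inner]
    change inner ℂ (u i (f j)) (u k (f l)) = _
    rw [← ContinuousLinearMap.adjoint_inner_right, ← ContinuousLinearMap.star_eq_adjoint, hu]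
    by_cases hik : i = k
    · rw [if_pos hik, hpf _ (f l).2, ← Submodule.coe_inner, orthonormal_iff_ite.1 f.orthonormal]
      simp [hik]
    · rw [if_neg hik, inner_zero_right, if_neg (by simp [hik])]
  have hspan : ⊤ ≤ Submodule.span ℂ (Set.range e) := by
    rintro v -
    obtain ⟨x, hx⟩ := mem_regSpace_iff.1 v.2
    have hmem : ∀ i, (star (u i)) ((x : H →L[ℂ] H) Ω) ∈ K := by
      intro i
      choose c hc using fun j => h.star_mul_mul x.2 i j
      have h1 : star (u i) * (x : H →L[ℂ] H) = ∑ j, c j • star (u j) := by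
        rw [← mul_one (star (u i) * (x : H →L[ℂ] H)), ← h.sum, Finset.mul_sum]
        refine Finset.sum_congr rfl fun j _ => ?_
        rw [← mul_assoc, hc, smul_mul_assoc, h.proj_mul_star]
      rw [← mul_apply_eq_comp, h1, _root_.sum_apply]
      exact sum_mem fun j _ => K.smul_mem _ (Submodule.subset_span ⟨j, rfl⟩)
    have hv : v = ∑ i, ∑ j, (f.repr ⟨_, hmem i⟩ j) • e (i, j) := by
      apply Subtype.ext
      rw [AddSubmonoidClass.coe_finsetSum]
      simp only [AddSubmonoidClass.coe_finsetSum]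
      have h1 : (v : H) = ∑ i, u i ((star (u i)) ((x : H →L[ℂ] H) Ω)) := by
        rw [← hx]
        have h2 := congrArg (fun y : H →L[ℂ] H => y ((x : H →L[ℂ] H) Ω)) h.sum
        simp only [_root_.sum_apply] at h2
        exact h2.symm
      rw [h1]
      refine Finset.sum_congr rfl fun i _ => ?_
      have h2 := congrArg Subtype.val (f.sum_repr ⟨_, hmem i⟩)
      rw [AddSubmonoidClass.coe_finsetSum] at h2
      have h3 := congrArg (u i) h2
      rw [map_sum] at h3
      rw [← h3]
      refine Finset.sum_congr rfl fun j _ => ?_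
      exact map_smul (u i) _ _
    rw [hv]
    exact sum_mem fun i _ => sum_mem fun j _ =>
      Submodule.smul_mem _ _ (Submodule.subset_span ⟨(i, j), rfl⟩)
  let E : OrthonormalBasis (Fin n × Fin n) ℂ (regSpace N Ω) := OrthonormalBasis.mk hon hspan
  let b := EuclideanSpace.basisFun (Fin n) ℂ
  let Φ := (b.tensorProduct b).equiv E (Equiv.refl _)
  have hΦ : ∀ i j, Φ (b i ⊗ₜ b j) = e (i, j) := by
    intro i j
    rw [← OrthonormalBasis.tensorProduct_apply, OrthonormalBasis.equiv_apply_basis]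
    simp [E]
  have key : ∀ (τ : Fin n → Fin n → ℂ) (x : N.toStarSubalgebra)
      (T : EuclideanSpace ℂ (Fin n) →ₗ[ℂ] EuclideanSpace ℂ (Fin n)),
      x = ∑ k, ∑ i, τ k i • h.units k i → (∀ i, T (b i) = ∑ k, τ k i • b k) →
      ∀ v, leftAction N Ω x (Φ v) = Φ (LinearMap.rTensor _ T v) := by
    intro τ x T hx hT v
    have hlin : (leftAction N Ω x).toLinearMap ∘ₗ Φ.toLinearEquiv.toLinearMap =
        Φ.toLinearEquiv.toLinearMap ∘ₗ LinearMap.rTensor _ T := by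
      refine (b.tensorProduct b).toBasis.ext fun y => ?_
      obtain ⟨i, j⟩ := y
      rw [OrthonormalBasis.coe_toBasis, OrthonormalBasis.tensorProduct_apply]
      change leftAction N Ω x (Φ (b i ⊗ₜ b j)) = Φ (LinearMap.rTensor _ T (b i ⊗ₜ b j))
      rw [hΦ, LinearMap.rTensor_tmul, hT, TensorProduct.sum_tmul, map_sum]
      simp only [← TensorProduct.smul_tmul', map_smul, hΦ]
      apply Subtype.ext
      rw [coe_leftAction, AddSubmonoidClass.coe_finsetSum]
      have hx' : (x : H →L[ℂ] H) = ∑ k, ∑ l, τ k l • (u k * star (u l)) := by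
        rw [hx, AddSubmonoidClass.coe_finsetSum]
        simp only [AddSubmonoidClass.coe_finsetSum]
        rfl
      rw [hx', _root_.sum_apply]
      refine Finset.sum_congr rfl fun k _ => ?_
      rw [_root_.sum_apply, Finset.sum_eq_single i]
      · change τ k i • u k ((star (u i)) (u i (f j))) = τ k i • u k (f j)
        rw [hu, if_pos rfl, hpf _ (f j).2]
      · intro l _ hl
        change τ k l • u k ((star (u l)) (u i (f j))) = 0
        rw [hu, if_neg hl, map_zero, smul_zero]
      · simp
    exact LinearMap.congr_fun hlin v
  refine ⟨⟨n, Φ, fun x => ?_, fun T => ?_⟩⟩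
  · obtain ⟨c, hc⟩ := h.isMatrixUnits.span x
    exact ⟨b.toBasis.constr ℂ fun i => ∑ k, c k i • b k, key c x _ hc fun i => by
      rw [← b.coe_toBasis, Module.Basis.constr_basis]⟩
  · refine ⟨_, key (fun k i => inner ℂ (b k) (T (b i))) _ T rfl fun i => ?_⟩
    exact (b.sum_repr' _).symm

end RegSpace

/-! ### Product structure of vectors of H_mu, and passage from M_lam to M_mu. -/

section Scheme

variable {Λ : Type*} [PartialOrder Λ] {H : Type*} [NormedAddCommGroup H]
  [InnerProductSpace ℂ H] [CompleteSpace H] (C : RenormalizationScheme Λ H) {lam mu : Λ}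

namespace RenormalizationScheme

theorem separating_sub (lam : Λ) : ∀ x ∈ C.sub lam, x C.Ω = 0 → x = 0 :=
  fun x hx => C.separating x (C.sub_le lam hx)

theorem sub_center (lam : Λ) (x : H →L[ℂ] H) (hx : x ∈ (C.sub lam).toStarSubalgebra)
    (h : ∀ y ∈ (C.sub lam).toStarSubalgebra, y * x = x * y) : ∃ c : ℂ, x = c • (1 : H →L[ℂ] H) :=
  (C.sub_typeI lam).1 x hx (VonNeumannAlgebra.mem_commutant_iff.2 h)

theorem exists_isMinimalProjection (lam : Λ) :
    ∃ p, IsMinimalProjection (C.sub lam).toStarSubalgebra p := by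
  obtain ⟨-, p, hp, hproj, hne, hc⟩ := C.sub_typeI lam
  exact ⟨p, hp, hproj, hne, hc⟩

theorem exists_frame (lam : Λ) [FiniteDimensional ℂ (C.sub lam).toStarSubalgebra] :
    ∃ (p : H →L[ℂ] H) (n : ℕ) (u : Fin n → H →L[ℂ] H),
      IsFrame (C.sub lam).toStarSubalgebra p u := by
  obtain ⟨p, hp⟩ := C.exists_isMinimalProjection lam
  exact ⟨p, hp.exists_frame (C.sub_center lam)⟩

theorem nonempty_bipartition (lam : Λ) [FiniteDimensional ℂ (C.sub lam).toStarSubalgebra] :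
    Nonempty (Bipartition (C.sub lam) C.Ω) := by
  obtain ⟨p, n, u, hu⟩ := C.exists_frame lam
  exact hu.nonempty_bipartition (C.separating_sub lam)

/-- The inclusion of the smaller regulated algebra, as a linear map. -/
def subInclusion (h : mu ≤ lam) :
    (C.sub mu).toStarSubalgebra →ₗ[ℂ] (C.sub lam).toStarSubalgebra where
  toFun x := ⟨x, C.sub_mono h x.2⟩
  map_add' _ _ := rfl
  map_smul' _ _ := rfl

theorem subInclusion_injective (h : mu ≤ lam) : Function.Injective (C.subInclusion h) :=
  fun _ _ hxy => Subtype.ext (congrArg (fun z : (C.sub lam).toStarSubalgebra => (z : H →L[ℂ] H)) hxy)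

theorem finiteDimensional_sub (h : mu ≤ lam)
    [FiniteDimensional ℂ (C.sub lam).toStarSubalgebra] :
    FiniteDimensional ℂ (C.sub mu).toStarSubalgebra :=
  FiniteDimensional.of_injective (C.subInclusion h) (C.subInclusion_injective h)

theorem finrank_sub_le (h : mu ≤ lam) [FiniteDimensional ℂ (C.sub lam).toStarSubalgebra] :
    Module.finrank ℂ (C.sub mu).toStarSubalgebra ≤ Module.finrank ℂ (C.sub lam).toStarSubalgebra :=
  LinearMap.finrank_le_finrank_of_injective (C.subInclusion_injective h)

/-- The state is invariant under compression by elements of `M_mu` after the conditional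
expectation. -/
theorem inner_mul_mul (a b : H →L[ℂ] H) (ha : a ∈ C.sub mu) (hb : b ∈ C.sub mu)
    (w : C.M.toStarSubalgebra) :
    inner ℂ C.Ω ((a * (w : H →L[ℂ] H) * b) C.Ω) =
      inner ℂ C.Ω ((a * (C.toSub mu w : H →L[ℂ] H) * b) C.Ω) := by
  have h := (C.toSub_condExp mu).bimodule ⟨a, ha⟩ ⟨b, hb⟩ w
  have h1 := C.invariant mu (⟨a, C.sub_le mu ha⟩ * w * ⟨b, C.sub_le mu hb⟩)
  rw [h] at h1
  exact h1.symm

theorem inner_toSub (w : C.M.toStarSubalgebra) :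
    inner ℂ C.Ω ((C.toSub mu w : H →L[ℂ] H) C.Ω) = inner ℂ C.Ω ((w : H →L[ℂ] H) C.Ω) :=
  C.invariant mu w

/-- The conditional expectation onto `M_mu` maps the commutant of `M_mu` to the scalars. -/
theorem exists_toSub_eq_smul (w : C.M.toStarSubalgebra)
    (hw : ∀ y ∈ C.sub mu, y * (w : H →L[ℂ] H) = w * y) :
    ∃ c : ℂ, (C.toSub mu w : H →L[ℂ] H) = c • (1 : H →L[ℂ] H) := by
  refine C.sub_center mu _ (C.toSub mu w).2 fun y hy => ?_
  have h1 := (C.toSub_condExp mu).bimodule ⟨y, hy⟩ 1 w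
  have h2 := (C.toSub_condExp mu).bimodule 1 ⟨y, hy⟩ w
  have h3 : (⟨y, C.sub_le mu hy⟩ * w * ⟨((1 : (C.sub mu).toStarSubalgebra) : H →L[ℂ] H),
      C.sub_le mu (1 : (C.sub mu).toStarSubalgebra).2⟩ : C.M.toStarSubalgebra) =
      ⟨((1 : (C.sub mu).toStarSubalgebra) : H →L[ℂ] H),
      C.sub_le mu (1 : (C.sub mu).toStarSubalgebra).2⟩ * w * ⟨y, C.sub_le mu hy⟩ := by
    apply Subtype.ext
    change y * (w : H →L[ℂ] H) * 1 = 1 * (w : H →L[ℂ] H) * y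
    rw [mul_one, one_mul, hw y hy]
  rw [h3, h2] at h1
  have h4 := congrArg Subtype.val h1
  change 1 * (C.toSub mu w : H →L[ℂ] H) * y = y * (C.toSub mu w : H →L[ℂ] H) * 1 at h4
  rw [one_mul, mul_one] at h4
  exact h4.symm

theorem mem_between_iff (x : H →L[ℂ] H) :
    x ∈ C.between lam mu ↔ x ∈ (C.sub lam).toStarSubalgebra ∧
      ∀ y ∈ (C.sub mu).toStarSubalgebra, y * x = x * y :=
  and_congr_right fun _ => VonNeumannAlgebra.mem_commutant_iff

/-- Vectors of `H_mu` are product vectors for `M_mu ⊗ M_{lam mu}`. -/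
theorem inner_mul_eq_mul [FiniteDimensional ℂ (C.sub mu).toStarSubalgebra]
    (Ψ : C.space mu) (hΨ : ‖Ψ‖ = 1) {x y : H →L[ℂ] H} (hy : y ∈ C.sub mu)
    (hx : x ∈ C.between lam mu) :
    inner ℂ (Ψ : H) ((y * x) (Ψ : H)) =
      inner ℂ (Ψ : H) (y (Ψ : H)) * inner ℂ (Ψ : H) (x (Ψ : H)) := by
  obtain ⟨η, hη⟩ := mem_regSpace_iff.1 Ψ.2
  obtain ⟨hxl, hxc⟩ := (C.mem_between_iff x).1 hx
  obtain ⟨c, hc⟩ := C.exists_toSub_eq_smul ⟨x, C.sub_le lam hxl⟩ hxc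
  -- With Ψ = ηΩ and η in M_mu, x commutes past η and η* z η lies in M_mu, so the conditional
  -- expectation replaces x by the scalar c. Taking z = 1 identifies c as the expectation of x in Ψ.
  have key : ∀ z ∈ C.sub mu, inner ℂ (Ψ : H) ((z * x) (Ψ : H)) =
      c * inner ℂ (Ψ : H) (z (Ψ : H)) := by
    intro z hz
    have hz' : star (η : H →L[ℂ] H) * z * η ∈ C.sub mu :=
      mul_mem (mul_mem (star_mem η.2) hz) η.2
    have h1 := C.inner_mul_mul (mu := mu) _ 1 hz' (C.sub mu).one_mem' ⟨x, C.sub_le lam hxl⟩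
    rw [hc, mul_one, mul_one, mul_smul_comm, mul_one] at h1
    have h2 : star (η : H →L[ℂ] H) * z * η * x = star (η : H →L[ℂ] H) * (z * x * η) := by
      rw [mul_assoc, hxc η η.2]
      simp only [mul_assoc]
    simp only [h2] at h1
    rw [mul_apply_eq_comp, ContinuousLinearMap.star_eq_adjoint,
      ContinuousLinearMap.adjoint_inner_right, mul_apply_eq_comp, hη] at h1
    rw [h1, _root_.smul_apply, inner_smul_right, mul_assoc, mul_apply_eq_comp,
      ContinuousLinearMap.adjoint_inner_right, mul_apply_eq_comp, hη]
  have h1 := key 1 (C.sub mu).one_mem'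
  rw [one_mul] at h1
  have h2 : inner ℂ (Ψ : H) ((1 : H →L[ℂ] H) (Ψ : H)) = 1 := by
    rw [one_apply_eq_self, inner_self_eq_norm_sq_to_K, Submodule.norm_coe, hΨ]
    simp
  rw [key y hy, h1, h2, mul_one, mul_comm]

/-- In compatible frames the product property says that the density matrix on M_lam is the Kronecker
product of the two others. All have trace 1, so the weights in `bipartiteEntropy_kronecker`
disappear. -/
theorem vectorEntropy_sub_eq_add (h : mu ≤ lam)
    [FiniteDimensional ℂ (C.sub lam).toStarSubalgebra] (Ψ : C.space mu) (hΨ : ‖Ψ‖ = 1) :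
    vectorEntropy (C.sub lam).toStarSubalgebra (Ψ : H) =
      vectorEntropy (C.sub mu).toStarSubalgebra (Ψ : H) +
        vectorEntropy (C.between lam mu) (Ψ : H) := by
  have := C.finiteDimensional_sub h
  obtain ⟨p, n, u, hu⟩ := C.exists_frame mu
  obtain ⟨q', hq'⟩ := C.exists_isMinimalProjection lam
  obtain ⟨q, m, t, hl, hb, hprod⟩ := hu.exists_relative (A' := (C.sub lam).toStarSubalgebra)
    (C.sub_mono h) hq' (C.sub_center lam) (C.between lam mu) C.mem_between_iff
  rw [hl.vectorEntropy_eq, hu.vectorEntropy_eq, hb.vectorEntropy_eq]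
  obtain ⟨X, hX, hX1⟩ := hu.exists_mul_conjTranspose (Ψ : H)
  obtain ⟨Y, hY, hY1⟩ := hb.exists_mul_conjTranspose (Ψ : H)
  rw [Submodule.norm_coe, hΨ, one_pow] at hX1 hY1
  have hXY : frameDensity (fun x : Fin n × Fin m => u x.1 * t x.2) (Ψ : H) =
      (X ⊗ₖ Y) * (X ⊗ₖ Y)ᴴ := by
    rw [conjTranspose_kronecker, ← mul_kronecker_mul, ← hX, ← hY]
    ext ⟨i, a⟩ ⟨j, b⟩
    rw [kronecker_apply]
    simp only [frameDensity, Matrix.of_apply]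
    rw [← hprod]
    exact C.inner_mul_eq_mul Ψ hΨ (mul_mem (hu.mem j) (star_mem (hu.mem i)))
      (mul_mem (hb.mem b) (star_mem (hb.mem a)))
  have hk := bipartiteEntropy_kronecker X Y
  rw [hX1, hY1, one_mul, one_mul] at hk
  rw [hXY, hX, hY]
  exact hk

/-- Unitaries of the right algebra of `M_mu` extend to the right algebra of `M_lam`. -/
theorem exists_extend_rightUnitary (h : mu ≤ lam)
    [FiniteDimensional ℂ (C.sub lam).toStarSubalgebra] (UR : RightUnitary (C.sub mu) C.Ω) :
    ∃ UR' : RightUnitary (C.sub lam) C.Ω, ∀ ψ : C.space mu,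
      UR'.1.1 (C.incl h ψ) = C.incl h (UR.1.1 ψ) := by
  have := C.finiteDimensional_sub h
  let Ω₀ : C.space mu := ⟨C.Ω, self_mem_regSpace _ _⟩
  let u₀ : unitary (C.space mu →L[ℂ] C.space mu) := ⟨UR.1.1, by
    have h1 := UR.2
    rw [Unitary.mem_iff] at h1 ⊢
    exact ⟨congrArg Subtype.val h1.1, congrArg Subtype.val h1.2⟩⟩
  have hcomm : ∀ x v, UR.1.1 (leftAction (C.sub mu) C.Ω x v) =
      leftAction (C.sub mu) C.Ω x (UR.1.1 v) := by
    intro x v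
    have h1 := (StarSubalgebra.mem_centralizer_iff ℂ).1 UR.1.2
    exact (DFunLike.congr_fun (h1 _ ⟨x, rfl⟩).1 v).symm
  -- An operator commuting with the left action is determined by its value zΩ at Ω: it is the right
  -- multiplication xΩ ↦ xzΩ. Its unitarity says that ω(z* w z) = ω(w) for w in M_mu.
  obtain ⟨z, hz⟩ := mem_regSpace_iff.1 (UR.1.1 Ω₀).2
  have hzin : ∀ w : (C.sub mu).toStarSubalgebra,
      inner ℂ C.Ω ((star (z : H →L[ℂ] H) * w * z) C.Ω) = inner ℂ C.Ω ((w : H →L[ℂ] H) C.Ω) := by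
    intro w
    rw [mul_assoc, mul_apply_eq_comp, ContinuousLinearMap.star_eq_adjoint,
      ContinuousLinearMap.adjoint_inner_right, mul_apply_eq_comp, hz]
    have h1 := Unitary.inner_map_map u₀ Ω₀ (leftAction (C.sub mu) C.Ω w Ω₀)
    change inner ℂ (UR.1.1 Ω₀) (UR.1.1 (leftAction (C.sub mu) C.Ω w Ω₀)) = _ at h1
    rw [hcomm] at h1
    exact h1
  have hzl : (z : H →L[ℂ] H) ∈ C.sub lam := C.sub_mono h z.2
  let L : (C.sub lam).toStarSubalgebra →ₗ[ℂ] C.space lam :=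
    { toFun := fun x => leftAction (C.sub lam) C.Ω x ⟨C.Ω, self_mem_regSpace _ _⟩
      map_add' := fun x y => rfl
      map_smul' := fun c x => rfl }
  have hL : ∀ x : (C.sub lam).toStarSubalgebra, (L x : H) = (x : H →L[ℂ] H) C.Ω := fun _ => rfl
  have hLbij : Function.Bijective L := by
    constructor
    · rw [injective_iff_map_eq_zero]
      intro x hx
      exact Subtype.ext (C.separating_sub lam x x.2 (congrArg Subtype.val hx))
    · intro v
      obtain ⟨x, hx⟩ := mem_regSpace_iff.1 v.2
      exact ⟨x, Subtype.ext hx⟩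
  let Γ := LinearEquiv.ofBijective L hLbij
  -- The extension is the same right multiplication by z, now on M_lam Ω.
  let R₀ : C.space lam →ₗ[ℂ] C.space lam :=
    L ∘ₗ LinearMap.mulRight ℂ (⟨z, hzl⟩ : (C.sub lam).toStarSubalgebra) ∘ₗ Γ.symm.toLinearMap
  have hR₀ : ∀ x, R₀ (L x) = L (x * ⟨z, hzl⟩) := by
    intro x
    have h1 : Γ.symm (L x) = x := Γ.symm_apply_apply x
    simp only [R₀, LinearMap.comp_apply, LinearEquiv.coe_coe, h1, LinearMap.mulRight_apply]
  have hinner : ∀ v w, inner ℂ (R₀ v) (R₀ w) = inner ℂ v w := by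
    intro v w
    obtain ⟨x, rfl⟩ := hLbij.2 v
    obtain ⟨y, rfl⟩ := hLbij.2 w
    rw [hR₀, hR₀, Submodule.coe_inner, Submodule.coe_inner, hL, hL, hL, hL]
    have hw : star (x : H →L[ℂ] H) * y ∈ C.M :=
      C.sub_le lam (mul_mem (star_mem x.2) y.2)
    -- With E the conditional expectation onto M_mu, ω(z* x* y z) = ω(z* E(x* y) z) = ω(E(x* y)) =
    -- ω(x* y): the invariance known on M_mu extends to M_lam.
    have h1 := C.inner_mul_mul (mu := mu) _ _ (star_mem z.2) z.2 ⟨_, hw⟩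
    rw [hzin, C.inner_toSub] at h1
    have h2 : star (z : H →L[ℂ] H) * (star (x : H →L[ℂ] H) * y) * z =
        star ((x : H →L[ℂ] H) * z) * ((y : H →L[ℂ] H) * z) := by
      rw [star_mul]
      simp only [mul_assoc]
    simp only [h2] at h1
    rw [mul_apply_eq_comp, ContinuousLinearMap.star_eq_adjoint,
      ContinuousLinearMap.adjoint_inner_right, mul_apply_eq_comp (star (x : H →L[ℂ] H)),
      ContinuousLinearMap.star_eq_adjoint, ContinuousLinearMap.adjoint_inner_right] at h1
    exact h1
  let R : C.space lam ≃ₗᵢ[ℂ] C.space lam :=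
    (R₀.isometryOfInner hinner).toLinearIsometryEquiv rfl
  have hR : ∀ v, R v = R₀ v := fun _ => rfl
  obtain ⟨UR', hUR'⟩ := exists_rightUnitary_of_commute R fun x v => by
    obtain ⟨y, rfl⟩ := hLbij.2 v
    have h1 : ∀ y, leftAction (C.sub lam) C.Ω x (L y) = L (x * y) := fun _ => rfl
    rw [hR, hR, hR₀, h1, h1, hR₀, mul_assoc]
  refine ⟨UR', fun ψ => ?_⟩
  obtain ⟨y, hy⟩ := mem_regSpace_iff.1 ψ.2
  have hψ : ψ = leftAction (C.sub mu) C.Ω y Ω₀ := Subtype.ext hy.symm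
  have hψ' : C.incl h ψ = L ⟨y, C.sub_mono h y.2⟩ := Subtype.ext hy.symm
  rw [hUR', hR, hψ', hR₀]
  apply Subtype.ext
  conv_rhs => rw [hψ, hcomm]
  change ((y : H →L[ℂ] H) * (z : H →L[ℂ] H)) C.Ω = (y : H →L[ℂ] H) ((UR.1.1 Ω₀ : C.space mu) : H)
  rw [← hz, mul_apply_eq_comp]

section Orbit

variable {X Y : Type*} [NormedAddCommGroup X] [InnerProductSpace ℂ X] [FiniteDimensional ℂ X]
  [NormedAddCommGroup Y] [InnerProductSpace ℂ Y] [FiniteDimensional ℂ Y]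
  [CompleteSpace X] [CompleteSpace Y] {V : H →L[ℂ] X ⊗[ℂ] Y} {δ : ℝ}

-- Left unitaries of M_mu already lie in M_lam, and right ones extend without changing their action
-- on H_mu, so the reconstructions for M_lam serve with the same error.
omit [FiniteDimensional ℂ X] [FiniteDimensional ℂ Y] in
theorem reconstructsOrbit_sub (h : mu ≤ lam)
    [FiniteDimensional ℂ (C.sub lam).toStarSubalgebra] {Ψ : C.space mu}
    (hrec : ReconstructsOrbit (C.sub lam) C.Ω V (C.incl h Ψ) δ) :
    ReconstructsOrbit (C.sub mu) C.Ω V Ψ δ := by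
  obtain ⟨tL, tR, ht⟩ := hrec
  choose uR huR using fun UR => C.exists_extend_rightUnitary h UR
  let uL : LeftUnitary (C.sub mu) → LeftUnitary (C.sub lam) := fun UL =>
    ⟨⟨UL.1, C.sub_mono h UL.1.2⟩, by
      have h1 := Unitary.mem_iff.1 UL.2
      have h2 : star (UL.1 : H →L[ℂ] H) * (UL.1 : H →L[ℂ] H) = 1 := congrArg Subtype.val h1.1
      have h3 : (UL.1 : H →L[ℂ] H) * star (UL.1 : H →L[ℂ] H) = 1 := congrArg Subtype.val h1.2
      exact Unitary.mem_iff.2 ⟨Subtype.ext h2, Subtype.ext h3⟩⟩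
  refine ⟨fun UL => tL (uL UL), fun UR => tR (uR UR), fun UL UR => ?_⟩
  have h1 : (act (uL UL) (uR UR) (C.incl h Ψ) : H) = act UL UR Ψ := by
    rw [act, huR]
    rfl
  rw [← h1]
  exact ht (uL UL) (uR UR)

end Orbit

end RenormalizationScheme

end Scheme

/-! ### Error bounds and their limits. -/

section Estimates

variable {H : Type*} [NormedAddCommGroup H] [InnerProductSpace ℂ H] [CompleteSpace H]
  {N : VonNeumannAlgebra H} {Ω : H}
  {X Y : Type*} [NormedAddCommGroup X] [InnerProductSpace ℂ X] [FiniteDimensional ℂ X]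
  [NormedAddCommGroup Y] [InnerProductSpace ℂ Y] [FiniteDimensional ℂ Y]
  [CompleteSpace X] [CompleteSpace Y] {V : H →L[ℂ] X ⊗[ℂ] Y} {δ : ℝ} {ψ : regSpace N Ω}

omit [FiniteDimensional ℂ X] [FiniteDimensional ℂ Y] in
theorem Reconstructs.reconstructsOrbit (h : Reconstructs N Ω V ψ δ) :
    ReconstructsOrbit N Ω V ψ δ := by
  obtain ⟨tL, tR, -, -, ht⟩ := h 1 1
  refine ⟨tL, tR, fun UL UR => ?_⟩
  have h1 : act 1 1 ψ = ψ := rfl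
  have h2 := ht UL UR
  rwa [h1] at h2

omit [FiniteDimensional ℂ X] [FiniteDimensional ℂ Y] in
theorem ReconstructsOrbit.nonneg (h : ReconstructsOrbit N Ω V ψ δ) : 0 ≤ δ := by
  obtain ⟨tL, tR, ht⟩ := h
  exact (norm_nonneg _).trans (ht 1 1)

/-- Product unitaries preserve the entropy, so this is continuity alone. -/
theorem abs_leftEntropy_sub_map_le (v w : X ⊗[ℂ] Y) (hv : ‖v‖ ≤ 1) (hw : ‖w‖ ≤ 1)
    (S : unitary (X →L[ℂ] X)) (T : unitary (Y →L[ℂ] Y))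
    (h : ‖v - TensorProduct.map S.1.toLinearMap T.1.toLinearMap w‖ ≤ δ) :
    |leftEntropy v - leftEntropy w| ≤ entropyModulus (Module.finrank ℂ X) δ := by
  let bX := stdOrthonormalBasis ℂ X
  let bY := stdOrthonormalBasis ℂ Y
  have hS := conjTranspose_toMatrixOrthonormal_mul bX S
  have hT := transpose_mul_conjTranspose_transpose _ (conjTranspose_toMatrixOrthonormal_mul bY T)
  have h1 : bipartiteEntropy (coeffs bX bY (TensorProduct.map S.1.toLinearMap T.1.toLinearMap w)) =
      bipartiteEntropy (coeffs bX bY w) := by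
    rw [coeffs_map]
    exact bipartiteEntropy_unitary_mul_mul _ _ _ hS hT
  have h2 : hsSq (coeffs bX bY (TensorProduct.map S.1.toLinearMap T.1.toLinearMap w)) =
      hsSq (coeffs bX bY w) := by
    rw [coeffs_map, hsSq_mul_unitary _ _ hT, hsSq_unitary_mul _ _ hS]
  rw [leftEntropy_eq_bipartiteEntropy bX bY, leftEntropy_eq_bipartiteEntropy bX bY, ← h1]
  have := abs_bipartiteEntropy_sub_le (coeffs bX bY v)
    (coeffs bX bY (TensorProduct.map S.1.toLinearMap T.1.toLinearMap w))
    (by rw [hsSq_coeffs]; exact pow_le_one₀ (norm_nonneg _) hv)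
    (by rw [h2, hsSq_coeffs]; exact pow_le_one₀ (norm_nonneg _) hw)
    ((norm_nonneg _).trans h)
    (by rw [← map_sub, hsSq_coeffs]; exact pow_le_pow_left₀ (norm_nonneg _) h 2)
  rwa [Fintype.card_fin] at this

theorem norm_act (UL : LeftUnitary N) (UR : RightUnitary N Ω) : ‖act UL UR ψ‖ = ‖ψ‖ := by
  have h1 : ‖UR.1.1 ψ‖ = ‖ψ‖ := by
    refine ContinuousLinearMap.norm_map_of_mem_unitary (u := UR.1.1) ?_ ψ
    have h1 := UR.2
    rw [Unitary.mem_iff] at h1 ⊢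
    exact ⟨congrArg Subtype.val h1.1, congrArg Subtype.val h1.2⟩
  rw [← h1]
  refine ContinuousLinearMap.norm_map_of_mem_unitary (u := UL.1.1) ?_ _
  have h1 := UL.2
  rw [Unitary.mem_iff] at h1 ⊢
  exact ⟨congrArg Subtype.val h1.1, congrArg Subtype.val h1.2⟩

theorem ReconstructsOrbit.abs_leftEntropy_act_sub_le (h : ReconstructsOrbit N Ω V ψ δ)
    (hV : ‖V‖ ≤ 1) (hψ : ‖ψ‖ = 1) (UL : LeftUnitary N) (UR : RightUnitary N Ω) :
    |leftEntropy (V (act UL UR ψ)) - leftEntropy (V ψ)| ≤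
      entropyModulus (Module.finrank ℂ X) δ := by
  obtain ⟨tL, tR, ht⟩ := h
  have hle : ∀ φ : regSpace N Ω, ‖φ‖ = 1 → ‖V φ‖ ≤ 1 := by
    intro φ hφ
    refine (V.le_of_opNorm_le hV _).trans ?_
    rw [one_mul, Submodule.norm_coe, hφ]
  exact abs_leftEntropy_sub_map_le _ _ (hle _ ((norm_act UL UR).trans hψ)) (hle _ hψ) _ _ (ht UL UR)

theorem entropyModulus_mono {m n : ℕ} (h : m ≤ n) (hδ : 0 ≤ δ) :
    entropyModulus m δ ≤ entropyModulus n δ := by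
  have hlog : Real.log m ≤ Real.log n := by
    rcases Nat.eq_zero_or_pos m with rfl | hm
    · simpa using Real.log_natCast_nonneg n
    · exact Real.log_le_log (by exact_mod_cast hm) (by exact_mod_cast h)
  simp only [entropyModulus]
  gcongr

/-- The error in the entropy formula, for boundary dimension `n`, bulk dimension at most `d`, and
boundary norm `r`. -/
def formulaError (n d : ℕ) (δ r : ℝ) : ℝ :=
  entropyModulus (n * (d * d)) δ + (1 - r ^ 2 + 2 * δ) * Real.log d

theorem ReconstructsOrbit.abs_entropy_formula_le (h : ReconstructsOrbit N Ω V ψ δ)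
    (hV : ‖V‖ ≤ 1) (hψ : ‖ψ‖ = 1) (hsep : ∀ x ∈ N, x Ω = 0 → x = 0)
    (hB : Nonempty (Bipartition N Ω)) {d : ℕ}
    (hd : Module.finrank ℂ N.toStarSubalgebra ≤ d ^ 2) :
    |vectorEntropy N.toStarSubalgebra (ψ : H) + areaTerm N Ω V - leftEntropy (V ψ)| ≤
      formulaError (Module.finrank ℂ X) d δ ‖V ψ‖ := by
  rw [areaTerm, dif_pos hB]
  set B := hB.some
  -- The algebra has dimension `B.d` squared. Bounding it by d keeps the error uniform in N even
  -- when the dimension of M_mu varies.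
  have hBd : B.d ≤ d := by
    obtain ⟨F, -⟩ := B.exists_starAlgEquiv hsep
    have h1 := LinearEquiv.finrank_eq F.toAlgEquiv.toLinearEquiv
    rw [Module.finrank_linearMap, finrank_euclideanSpace_fin] at h1
    rw [← h1, ← sq] at hd
    exact (Nat.pow_le_pow_iff_left two_ne_zero).1 hd
  have hδ := h.nonneg
  have h1 : ‖V ψ‖ ≤ 1 := by
    refine (V.le_of_opNorm_le hV _).trans ?_
    rw [one_mul, Submodule.norm_coe, hψ]
  have h2 : ‖V ψ‖ ^ 2 ≤ 1 := pow_le_one₀ (norm_nonneg _) h1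
  refine (B.abs_entropy_add_sub_le V hsep hV ψ hψ h).trans (add_le_add ?_ ?_)
  · exact entropyModulus_mono (Nat.mul_le_mul_left _ (Nat.mul_le_mul hBd hBd)) hδ
  · refine mul_le_mul_of_nonneg_left ?_ (by linarith)
    rcases Nat.eq_zero_or_pos B.d with h0 | h0
    · rw [h0]
      simpa using Real.log_natCast_nonneg d
    · exact Real.log_le_log (by exact_mod_cast h0) (by exact_mod_cast hBd)

/-- The only growing quantity is the logarithm of the boundary dimension; it enters multiplied by δ,
and superpolynomial decay absorbs the polynomial P. -/
theorem tendsto_entropyModulus {n : ℕ → ℕ} {δ : ℕ → ℝ} {P : Polynomial ℝ}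
    (hP : ∀ N : ℕ, Real.log (n N) ≤ P.eval (N : ℝ))
    (hδ : Asymptotics.SuperpolynomialDecay atTop (fun N : ℕ => (N : ℝ)) δ) (hδ0 : ∀ N, 0 ≤ δ N)
    (d : ℕ) : Tendsto (fun N => entropyModulus (n N * d) (δ N)) atTop (𝓝 0) := by
  have h0 : Tendsto δ atTop (𝓝 0) := by
    simpa using hδ 0
  have h1 : Tendsto (fun N : ℕ => P.eval (N : ℝ) * δ N) atTop (𝓝 0) := by
    simpa using hδ.polynomial_mul P 0
  have hlim : Tendsto (fun N : ℕ => 2 * (P.eval (N : ℝ) * δ N) + 2 * δ N * Real.log d +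
      (2 * √(2 * δ N) + 2 * δ N)) atTop (𝓝 0) := by
    have h2 : Tendsto (fun N => √(2 * δ N)) atTop (𝓝 0) := by
      simpa using (h0.const_mul 2).sqrt
    simpa using ((h1.const_mul 2).add ((h0.const_mul 2).mul_const (Real.log d))).add
      ((h2.const_mul 2).add (h0.const_mul 2))
  refine squeeze_zero (fun N => ?_) (fun N => ?_) hlim
  · have := hδ0 N
    have := Real.log_natCast_nonneg (n N * d)
    simp only [entropyModulus]
    positivity
  · simp only [entropyModulus]
    refine add_le_add_left ?_ _
    have hlog : Real.log ((n N * d : ℕ) : ℝ) ≤ P.eval (N : ℝ) + Real.log d := by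
      -- The logarithm of the product splits only for nonzero factors. A vanishing factor makes the
      -- left side 0, by the convention log 0 = 0.
      rcases Nat.eq_zero_or_pos (n N) with hn | hn
      · have h3 := hP N
        have h4 := Real.log_natCast_nonneg d
        rw [hn] at h3 ⊢
        simp at h3 ⊢
        linarith
      rcases Nat.eq_zero_or_pos d with hd | hd
      · have h3 := hP N
        have h4 := Real.log_natCast_nonneg (n N)
        rw [hd]
        simp
        linarith
      · rw [Nat.cast_mul, Real.log_mul (by positivity) (by positivity)]
        linarith [hP N]
    have := mul_le_mul_of_nonneg_left hlog (mul_nonneg zero_le_two (hδ0 N))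
    linarith

theorem tendsto_formulaError {n : ℕ → ℕ} {δ r : ℕ → ℝ} {P : Polynomial ℝ}
    (hP : ∀ N : ℕ, Real.log (n N) ≤ P.eval (N : ℝ))
    (hδ : Asymptotics.SuperpolynomialDecay atTop (fun N : ℕ => (N : ℝ)) δ) (hδ0 : ∀ N, 0 ≤ δ N)
    (hr : Tendsto r atTop (𝓝 1)) (d : ℕ) :
    Tendsto (fun N => formulaError (n N) d (δ N) (r N)) atTop (𝓝 0) := by
  have h0 : Tendsto δ atTop (𝓝 0) := by
    simpa using hδ 0
  have h1 := (((hr.pow 2).const_sub 1).add (h0.const_mul 2)).mul_const (Real.log d)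
  simpa [formulaError] using (tendsto_entropyModulus hP hδ hδ0 (d * d)).add h1

end Estimates

end LargeNCode
end

/-! ### The main theorem. -/

open LargeNCode in
theorem mainTheorem1
    {Λ : Type*} [PartialOrder Λ] (lam mu : Λ) (hle : mu ≤ lam)
    -- the bulk: a code subspace renormalization scheme, allowed to depend on `N`
    (H : ℕ → Type*) [∀ N, NormedAddCommGroup (H N)] [∀ N, InnerProductSpace ℂ (H N)]
    [∀ N, CompleteSpace (H N)]
    (C : ∀ N, RenormalizationScheme Λ (H N))
    -- the boundary Hilbert spaces and the contractive bulk-to-boundary maps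
    (K : ℕ → Type*) [∀ N, NormedAddCommGroup (K N)] [∀ N, InnerProductSpace ℂ (K N)]
    [∀ N, CompleteSpace (K N)] [∀ N, FiniteDimensional ℂ (K N)]
    (V : ∀ N, H N →L[ℂ] K N ⊗[ℂ] K N) (hV : ∀ N, ‖V N‖ ≤ 1)
    -- `M_lam` is finite-dimensional, of dimension `d²` independent of `N`
    (d : ℕ) (hfin : ∀ N, FiniteDimensional ℂ ((C N).sub lam).toStarSubalgebra)
    (hd : ∀ N, Module.finrank ℂ ((C N).sub lam).toStarSubalgebra = d ^ 2)
    -- the logarithm of the boundary dimension is polynomially bounded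
    (P : Polynomial ℝ) (hP : ∀ N : ℕ, Real.log (Module.finrank ℂ (K N)) ≤ P.eval (N : ℝ))
    -- the normalized state, on which the code is asymptotically isometric
    (Ψ : ∀ N, (C N).space mu) (hΨ : ∀ N, ‖Ψ N‖ = 1)
    (hiso : Tendsto (fun N => ‖V N (Ψ N)‖) atTop (𝓝 1))
    -- reconstruction of the unitaries of `M_lam`
    (δ : ℕ → ℝ) (hδ : Asymptotics.SuperpolynomialDecay atTop (fun N : ℕ => (N : ℝ)) δ)
    (hrec : ∀ N, Reconstructs ((C N).sub lam) (C N).Ω (V N) ((C N).incl hle (Ψ N)) (δ N)) :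
    (∀ (UL : ∀ N, LeftUnitary ((C N).sub mu)) (UR : ∀ N, RightUnitary ((C N).sub mu) (C N).Ω),
      Tendsto (fun N =>
        |vectorEntropy ((C N).sub mu).toStarSubalgebra (Ψ N : H N)
          + areaTerm ((C N).sub mu) (C N).Ω (V N)
          - leftEntropy (V N (act (UL N) (UR N) (Ψ N)))|) atTop (𝓝 0) ∧
      Tendsto (fun N =>
        |vectorEntropy ((C N).sub mu).toStarSubalgebra (Ψ N : H N)
          + vectorEntropy ((C N).between lam mu) (Ψ N : H N)
          + areaTerm ((C N).sub lam) (C N).Ω (V N)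
          - leftEntropy (V N (act (UL N) (UR N) (Ψ N)))|) atTop (𝓝 0)) ∧
    Tendsto (fun N =>
      |areaTerm ((C N).sub mu) (C N).Ω (V N)
        - (vectorEntropy ((C N).between lam mu) (Ψ N : H N)
          + areaTerm ((C N).sub lam) (C N).Ω (V N))|) atTop (𝓝 0) := by
  have hfin' : ∀ N, FiniteDimensional ℂ ((C N).sub mu).toStarSubalgebra := fun N =>
    (C N).finiteDimensional_sub hle
  have hΨ' : ∀ N, ‖(C N).incl hle (Ψ N)‖ = 1 := hΨ
  have R_lam := fun N => (hrec N).reconstructsOrbit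
  have R_mu := fun N => (C N).reconstructsOrbit_sub hle (R_lam N)
  have hδ0 : ∀ N, 0 ≤ δ N := fun N => (R_lam N).nonneg
  have e_mu := fun N => (R_mu N).abs_entropy_formula_le (hV N) (hΨ N) ((C N).separating_sub mu)
    ((C N).nonempty_bipartition mu) (((C N).finrank_sub_le hle).trans (hd N).le)
  have e_lam : ∀ N, |vectorEntropy ((C N).sub mu).toStarSubalgebra (Ψ N : H N)
      + vectorEntropy ((C N).between lam mu) (Ψ N : H N)
      + areaTerm ((C N).sub lam) (C N).Ω (V N) - leftEntropy (V N (Ψ N))| ≤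
      formulaError (Module.finrank ℂ (K N)) d (δ N) ‖V N (Ψ N)‖ := fun N => by
    rw [← (C N).vectorEntropy_sub_eq_add hle (Ψ N) (hΨ N)]
    exact (R_lam N).abs_entropy_formula_le (hV N) (hΨ' N) ((C N).separating_sub lam)
      ((C N).nonempty_bipartition lam) (hd N).le
  have hF := tendsto_formulaError hP hδ hδ0 hiso d
  have hM := tendsto_entropyModulus hP hδ hδ0 1
  simp only [mul_one] at hM
  refine ⟨fun UL UR => ?_, ?_⟩
  -- The formulas hold for VΨ; rotating Ψ by Û costs one further modulus of continuity.
  · have e_act := fun N => (R_mu N).abs_leftEntropy_act_sub_le (hV N) (hΨ N) (UL N) (UR N)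
    have hFM := hF.add hM
    rw [add_zero] at hFM
    constructor
    · refine squeeze_zero (fun _ => abs_nonneg _) (fun N => ?_) hFM
      have h := (abs_sub_le _ _ (leftEntropy (V N (act (UL N) (UR N) (Ψ N))))).trans
        (add_le_add (e_mu N) ((abs_sub_comm _ _).trans_le (e_act N)))
      exact h
    · refine squeeze_zero (fun _ => abs_nonneg _) (fun N => ?_) hFM
      have h := (abs_sub_le _ _ (leftEntropy (V N (act (UL N) (UR N) (Ψ N))))).trans
        (add_le_add (e_lam N) ((abs_sub_comm _ _).trans_le (e_act N)))
      exact h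
  · have hFF := hF.add hF
    rw [add_zero] at hFF
    refine squeeze_zero (fun _ => abs_nonneg _) (fun N => ?_) hFF
    -- Both formulas approximate S(VΨ), and the common term S(Ψ, M_mu) cancels in their difference.
    refine le_trans (le_of_eq ?_) ((abs_sub_le _ _ _).trans
      (add_le_add (e_mu N) ((abs_sub_comm _ _).trans_le (e_lam N))))
    congr 1
    ring
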